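/- A strict partition is a finite (possibly empty) strictly decreasing sequence $\lambda=(\lambda_1>\lambda_2>\dots>\lambda_\ell>0)$ of positive integers. Its shifted diagram is the set of boxes $\mathsf{SD}_\lambda=\{(i,j): 1\le i\le \ell,\ i\le j<i+\lambda_i\}$, and $|\lambda|=|\mathsf{SD}_\lambda|$. Consider the ordered alphabet $1'<1<2'<2<3'<3<\cdots$. A semistandard set-valued shifted tableau $T$ of shape $\lambda$ assigns to each box $(i,j)\in\mathsf{SD}_\lambda$ a nonempty finite subset $T_{ij}$ of this alphabet such that (S1) rows and columns are weakly increasing, i.e. $\max T_{ij}\le\min T_{i,j+1}$ and $\max T_{ij}\le \min T_{i+1,j}$ whenever the boxes involved are in $\mathsf{SD}_\lambda$; (S2) no unprimed number $i$ occurs in more than one box of the same column; (S3) no primed number $i'$ occurs in more than one box of the same row. Let $\mathrm{SetShYT}_Q(\lambda)$ be the set of all these tableaux, and let $\mathrm{SetShYT}_P(\lambda)$ be the subset of those with no primed number in any diagonal box $(j,j)$. Put $|T|=\sum_{(i,j)\in\mathsf{SD}_\lambda}|T_{ij}|$ and $x^T=\prod_{i\ge1}x_i^{m_i}$, where $m_i$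 is the total number of occurrences of $i$ and $i'$ in $T$. The $K$-theoretic Schur $P$- and $Q$-functions are the power series in $\mathbb{Z}[\beta][[x_1,x_2,\dots]]$ $$GP_\lambda=\sum_{T\in\mathrm{SetShYT}_P(\lambda)}\beta^{|T|-|\lambda|}x^T,\qquad GQ_\lambda=\sum_{T\in\mathrm{SetShYT}_Q(\lambda)}\beta^{|T|-|\lambda|}x^T .$$ **Corollary.** Let $\mu$ be a strict partition. Then $GQ_\mu$ is a (finite) $\mathbb{N}[\beta]$-linear combination of the functions $GP_\lambda$, with $\lambda$ ranging over strict partitions and $\mathbb{N}=\{0,1,2,\dots\}$, if and only if any two distinct parts of $\mu$ differ by at least two. -/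

import Mathlib

open scoped Polynomial

/-- A strict partition: a strictly decreasing finite sequence of positive integers. -/
structure StrictPartition where
  /-- the parts, listed in decreasing order -/
  parts : List ℕ
  strictAnti : parts.Pairwise (· > ·)
  pos : ∀ a ∈ parts, 0 < a

namespace StrictPartition

/-- The shifted diagram, with rows and columns numbered from `0`: row `i` consists of the boxes
`(i, j)` with `i ≤ j < i + lam_i`, where `lam_i` is the part in position `i` (and `0` if there is
no such part). -/
def shiftedDiagram (lam : StrictPartition) : Finset (ℕ × ℕ) :=
  (Finset.range lam.parts.length).biUnion fun i =>
    (Finset.Ico i (i + lam.parts.getD i 0)).image fun j => (i, j)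

theorem mem_shiftedDiagram (lam : StrictPartition) (i j : ℕ) :
    (i, j) ∈ lam.shiftedDiagram ↔ i ≤ j ∧ j < i + lam.parts.getD i 0 := by
  simp only [shiftedDiagram, Finset.mem_biUnion, Finset.mem_range, Finset.mem_image,
    Finset.mem_Ico, Prod.mk.injEq]
  constructor
  · rintro ⟨a, -, b, hb, rfl, rfl⟩
    exact hb
  · intro h
    refine ⟨i, ?_, j, h, rfl, rfl⟩
    by_contra hi
    rw [List.getD_eq_default _ _ (not_lt.mp hi)] at h
    omega

/-- The semistandard set-valued (`Q`-)shifted tableaux of shape `lam`.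

The alphabet `1' < 1 < 2' < 2 < ⋯` is encoded by `0 < 1 < 2 < 3 < ⋯`: the natural number `a` stands
for the half-integer `(a + 1) / 2`.  Thus `a` is primed iff `a` is even, and both `2 * k` and
`2 * k + 1` carry the variable with number `k` (variables being numbered from `0`).

A filling assigns to each box of the diagram a nonempty finite set, and is
extended by the empty set outside of the diagram. -/
structure IsSetShYTQ (lam : StrictPartition) (T : ℕ × ℕ → Finset ℕ) : Prop where
  nonempty : ∀ c ∈ lam.shiftedDiagram, (T c).Nonempty
  eq_empty : ∀ c, c ∉ lam.shiftedDiagram → T c = ∅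
  /-- rows are weakly increasing: the maximum of a box is at most the minimum of each later box -/
  row_weak : ∀ i j j', j < j' → ∀ a ∈ T (i, j), ∀ b ∈ T (i, j'), a ≤ b
  /-- columns are weakly increasing -/
  col_weak : ∀ i i' j, i < i' → ∀ a ∈ T (i, j), ∀ b ∈ T (i', j), a ≤ b
  /-- no unprimed number occurs more than once in a column -/
  col_unprimed : ∀ a, Odd a → ∀ i i' j, a ∈ T (i, j) → a ∈ T (i', j) → i = i'
  /-- no primed number occurs more than once in a row -/
  row_primed : ∀ a, Even a → ∀ i j j', a ∈ T (i, j) → a ∈ T (i, j') → j = j'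

/-- The semistandard set-valued `P`-shifted tableaux of shape `lam`: those without primed numbers
in diagonal boxes. -/
structure IsSetShYTP (lam : StrictPartition) (T : ℕ × ℕ → Finset ℕ) : Prop
    extends IsSetShYTQ lam T where
  diag_unprimed : ∀ i, ∀ a ∈ T (i, i), ¬ Even a

/-- The total number `|T|` of entries of a filling `T` of the diagram of `lam`. -/
def numEntries (lam : StrictPartition) (T : ℕ × ℕ → Finset ℕ) : ℕ :=
  ∑ c ∈ lam.shiftedDiagram, (T c).card

/-- The exponent vector of the monomial `x^T`. -/
noncomputable def weight (lam : StrictPartition) (T : ℕ × ℕ → Finset ℕ) : ℕ →₀ ℕ :=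
  ∑ c ∈ lam.shiftedDiagram, ∑ a ∈ T c, Finsupp.single (a / 2) 1

theorem IsSetShYTQ.card_le_numEntries {lam : StrictPartition} {T : ℕ × ℕ → Finset ℕ}
    (hT : lam.IsSetShYTQ T) : lam.shiftedDiagram.card ≤ lam.numEntries T := by
  rw [Finset.card_eq_sum_ones]
  exact Finset.sum_le_sum fun c hc => Finset.card_pos.mpr (hT.nonempty c hc)

/-- Only finitely many tableaux have a given shape and weight. -/
theorem finite_setShYTQ (lam : StrictPartition) (d : ℕ →₀ ℕ) :
    {T | lam.IsSetShYTQ T ∧ lam.weight T = d}.Finite := by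
  classical
  let A : Finset ℕ := d.support.biUnion fun k => {2 * k, 2 * k + 1}
  have hA : ∀ T, lam.weight T = d → ∀ c ∈ lam.shiftedDiagram, T c ⊆ A := by
    intro T hT c hc a ha
    have h1 : (1 : ℕ) ≤ d (a / 2) := by
      rw [← hT, weight, Finsupp.finsetSum_apply]
      refine le_trans ?_ (Finset.single_le_sum (fun _ _ => Nat.zero_le _) hc)
      rw [Finsupp.finsetSum_apply]
      refine le_trans ?_ (Finset.single_le_sum (fun _ _ => Nat.zero_le _) ha)
      simp
    simp only [A, Finset.mem_biUnion, Finsupp.mem_support_iff, Finset.mem_insert,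
      Finset.mem_singleton]
    exact ⟨a / 2, by omega, by omega⟩
  let r : (ℕ × ℕ → Finset ℕ) → (lam.shiftedDiagram → Finset ℕ) := fun T c => T c
  refine Set.Finite.of_finite_image (f := r) ?_ ?_
  · refine (Set.Finite.pi' (t := fun _ => (A.powerset : Set (Finset ℕ)))
      fun _ => Finset.finite_toSet _).subset ?_
    rintro _ ⟨T, ⟨-, hT⟩, rfl⟩ c
    simpa [r] using hA T hT c c.2
  · rintro T ⟨hT, -⟩ T' ⟨hT', -⟩ h
    funext c
    by_cases hc : c ∈ lam.shiftedDiagram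
    · exact congrFun h ⟨c, hc⟩
    · rw [hT.eq_empty c hc, hT'.eq_empty c hc]

theorem finite_setShYTP (lam : StrictPartition) (d : ℕ →₀ ℕ) :
    {T | lam.IsSetShYTP T ∧ lam.weight T = d}.Finite :=
  (lam.finite_setShYTQ d).subset fun _ h => ⟨h.1.toIsSetShYTQ, h.2⟩

/-- The `K`-theoretic Schur `P`-function `∑_T β^(|T| - |lam|) x^T` in `ℤ[β][[x₀, x₁, …]]`, the sum
over all set-valued `P`-shifted tableaux of shape `lam`, given by its coefficients; `β` is the
polynomial variable.  The exponent is a true difference by `IsSetShYTQ.card_le_numEntries`. -/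
noncomputable def GP (lam : StrictPartition) : MvPowerSeries ℕ ℤ[X] := fun d =>
  ∑ T ∈ (lam.finite_setShYTP d).toFinset,
    Polynomial.X ^ (lam.numEntries T - lam.shiftedDiagram.card)

/-- The `K`-theoretic Schur `Q`-function, the same generating function over all set-valued
`Q`-shifted tableaux of shape `lam`. -/
noncomputable def GQ (lam : StrictPartition) : MvPowerSeries ℕ ℤ[X] := fun d =>
  ∑ T ∈ (lam.finite_setShYTQ d).toFinset,
    Polynomial.X ^ (lam.numEntries T - lam.shiftedDiagram.card)

end StrictPartition

/-!
A strict partition is the set of its parts, so it is encoded by the natural number whose binary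
digit `p` says whether `p + 1` is a part (`StrictPartition.code`). Under this encoding
`height n p`, the number of parts exceeding `p`, is the number of boxes of the shifted diagram on
the diagonal `j - i = p`.

A set-valued tableau is built letter by letter. Passing from the letters below `a` to the letters
below `a + 1` enlarges the shape from `nu` to `lam` and marks with `a` the boxes of `lam / nu`
together with an arbitrary set of admissible corners of `nu`; this contributes
`x ^ |lam / nu| * (1 + β x) ^ #corners` if `lam / nu` is a vertical strip (for a primed letter) or a
horizontal strip (for an unprimed one), and `0` otherwise (`genFun_succ`). Read along the diagonals,
these weights are local, so each step is a transfer matrix of a one-dimensional lattice model: a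
deterministic finite-state transducer on binary words (`letterStep_pointMass`). Primed letters
differ between the `P`- and the `Q`-case only in the initial state of the transducer.

A third transducer, `hop`, lets every particle of a binary word stay, with weight `2`, or move one
step up, with weight `β`; a particle that has to leave its site because the one below moves there is
counted with `-β`. The heart of the proof is that `hop` intertwines the two-letter steps,
`addQ ∘ hop = hop ∘ addP` (`addQ_hop`). This is a statement about finite-state automata, and it
follows from six linear relations between products of transducers which are closed under reading
one more digit (`strips_hop`). By induction on the number of variables `GQ_mu` is the image of the
family `GP` under `hop` (`genFun_eq_hop`, `StrictPartition.GQ_eq_sum`), that is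
`GQ_mu = ∑ ± 2 ^ (ℓ - k) β ^ k GP_lam`, over the `lam` obtained from `mu` by adding `k` boxes, at
most one in each row, without changing the number `ℓ` of rows.

The weight `-β` can be used only where two consecutive numbers are parts, so the coefficients are in
`ℕ[β]` if distinct parts differ by at least two. Otherwise some coefficient is
`-2 ^ k * β ^ 2` (`exists_hop_pointMass_neg`). Since the `GP_lam` are linearly
independent over `ℤ[β]` (`StrictPartition.linearIndependent_GP`), there is no other expansion.
-/

/-! ### Transducers on binary words -/

section Transfer

variable {R S : Type*} [CommRing R]

/-- The operator on functions of binary words (encoded as natural numbers, lowest digit first)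
given by a deterministic transducer: in state `s`, reading the outer digit `b` and the inner digit
`c` has weight `ω s b c` and leads to the state `τ s b c`. The value at the word `l` is the sum over
all inner words of the total weight times the value of `f`. The functional `e s` is the value at the
word `0`, which stands for infinitely many digits `0`. -/
noncomputable def transfer (ω : S → Bool → Bool → R) (τ : S → Bool → Bool → S)
    (e : S → (ℕ → R) → R) (l : ℕ) : S → (ℕ → R) → R :=
  Nat.binaryRec (motive := fun _ => S → (ℕ → R) → R) e
    (fun b _ ih s f => ω s b false * ih (τ s b false) (fun k => f (Nat.bit false k)) +
      ω s b true * ih (τ s b true) (fun k => f (Nat.bit true k))) l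

theorem transfer_zero (ω : S → Bool → Bool → R) (τ : S → Bool → Bool → S)
    (e : S → (ℕ → R) → R) (s : S) (f : ℕ → R) : transfer ω τ e 0 s f = e s f := by
  simp [transfer]

/-- The recursion of a transducer. The hypothesis says that the boundary functional is compatible
with reading one more leading digit `0`. -/
theorem transfer_bit {ω : S → Bool → Bool → R} {τ : S → Bool → Bool → S}
    {e : S → (ℕ → R) → R}
    (he : ∀ s f, ω s false false * e (τ s false false) (fun k => f (Nat.bit false k)) +
      ω s false true * e (τ s false true) (fun k => f (Nat.bit true k)) = e s f)
    (b : Bool) (m : ℕ) (s : S) (f : ℕ → R) :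
    transfer ω τ e (Nat.bit b m) s f =
      ω s b false * transfer ω τ e m (τ s b false) (fun k => f (Nat.bit false k)) +
      ω s b true * transfer ω τ e m (τ s b true) (fun k => f (Nat.bit true k)) := by
  unfold transfer
  rw [Nat.binaryRec_eq]
  left
  funext s f
  exact he s f

/-- The states of the transducers for one letter. A binary word is a configuration of particles, the
shape grows as particles move up, and a state describes the bond between two consecutive
sites. -/
inductive Bond
  /-- no particle crosses, and a particle staying at the next site is a corner that may be marked -/
  | free
  /-- no particle crosses, and the particle at the next site is not a corner that may be marked -/
  | blocked
  /-- a particle crosses, that is, there is a new box on this diagonal -/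
  | moving
  deriving DecidableEq

open Bond

/-- The boundary condition: no particle crosses a bond beyond the last digit `1`. -/
def boundary : Bond → (ℕ → R) → R
  | moving, _ => 0
  | _, f => f 0

/-- The weights for a primed letter with variable `x`, where `u = 1 + β x`. A particle moves by at
most one site, with weight `x`. A staying particle gets the factor `u` if it is a corner that may be
marked, which means that there is no inner particle just below it. -/
def vWeight (x u : R) : Bond → Bool → Bool → R
  | free, false, false => 1
  | free, false, true => x
  | free, true, true => u
  | free, true, false => 0
  | blocked, false, false => 1
  | blocked, false, true => x
  | blocked, true, true => 1
  | blocked, true, false => 0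
  | moving, true, false => 1
  | moving, true, true => x
  | moving, false, _ => 0

/-- The next state for a primed letter; it is blocked by an inner particle. -/
def vNext : Bond → Bool → Bool → Bond
  | moving, true, true => moving
  | _, true, true => blocked
  | _, false, true => moving
  | _, _, false => free

/-- The weights for an unprimed letter with variable `x`, where `u = 1 + β x`. A particle moves with
weight `x` per site, stopping below the inner position of the next particle. A particle gets
the factor `u` if there is no outer particle just below its inner position. -/
def hWeight (x u : R) : Bond → Bool → Bool → R
  | free, false, false => 1
  | free, false, true => x * u
  | free, true, true => u
  | free, true, false => 0
  | blocked, false, false => 1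
  | blocked, false, true => x
  | blocked, true, true => 1
  | blocked, true, false => 0
  | moving, true, false => 1
  | moving, false, false => x
  | moving, _, true => 0

/-- The next state for an unprimed letter; it is blocked by an outer particle. -/
def hNext : Bond → Bool → Bool → Bond
  | moving, false, false => moving
  | _, true, _ => blocked
  | _, false, true => moving
  | _, false, false => free

/-- The operator of a primed letter, which adds a vertical strip. -/
noncomputable def vStrip (x u : R) (s : Bond) (f : ℕ → R) (l : ℕ) : R :=
  transfer (vWeight x u) vNext boundary l s f

/-- The operator of an unprimed letter, which adds a horizontal strip. -/
noncomputable def hStrip (x u : R) (s : Bond) (f : ℕ → R) (l : ℕ) : R :=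
  transfer (hWeight x u) hNext boundary l s f

/-- The weights of the operator `hop`; the outer particles move up by at most one site, and the state
is `true` if a particle crosses the bond. The sign occurs
for a particle pushed off its site by the one below. -/
def hopWeight (b : R) : Bool → Bool → Bool → R
  | false, false, false => 1
  | false, true, true => 2
  | false, true, false => b
  | false, false, true => 0
  | true, false, true => 1
  | true, true, true => -b
  | true, _, false => 0

/-- The next state of the operator `hop`. -/
def hopNext : Bool → Bool → Bool → Bool
  | false, true, false => true
  | true, true, true => true
  | _, _, _ => false

/-- The boundary condition of `hop`: a particle crossing the last bond lands on the next site. -/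
def hopBoundary : Bool → (ℕ → R) → R
  | false, f => f 0
  | true, f => f 1

/-- The operator expressing `GQ` by `GP`: starting from state `false`, its matrix entry at
`(mu, lam)` is the coefficient of `GP_lam` in `GQ_mu`. -/
noncomputable def hop (b : R) (s : Bool) (f : ℕ → R) (m : ℕ) : R :=
  transfer (hopWeight b) hopNext hopBoundary m s f

variable (x u b : R) (f : ℕ → R) (m : ℕ)

theorem vStrip_bit (s : Bond) (c : Bool) : vStrip x u s f (Nat.bit c m) =
      vWeight x u s c false * vStrip x u (vNext s c false) (fun k => f (Nat.bit false k)) m +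
      vWeight x u s c true * vStrip x u (vNext s c true) (fun k => f (Nat.bit true k)) m :=
  transfer_bit (by rintro (_ | _ | _) f <;> simp [vWeight, vNext, boundary]) c m s f

theorem hStrip_bit (s : Bond) (c : Bool) : hStrip x u s f (Nat.bit c m) =
      hWeight x u s c false * hStrip x u (hNext s c false) (fun k => f (Nat.bit false k)) m +
      hWeight x u s c true * hStrip x u (hNext s c true) (fun k => f (Nat.bit true k)) m :=
  transfer_bit (by rintro (_ | _ | _) f <;> simp [hWeight, hNext, boundary]) c m s f

theorem hop_bit (s : Bool) (c : Bool) : hop b s f (Nat.bit c m) =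
      hopWeight b s c false * hop b (hopNext s c false) (fun k => f (Nat.bit false k)) m +
      hopWeight b s c true * hop b (hopNext s c true) (fun k => f (Nat.bit true k)) m :=
  transfer_bit (by rintro (_ | _) f <;> simp [hopWeight, hopNext, hopBoundary]) c m s f

theorem vStrip_zero (s : Bond) : vStrip x u s f 0 = boundary s f := transfer_zero ..
theorem hStrip_zero (s : Bond) : hStrip x u s f 0 = boundary s f := transfer_zero ..
theorem hop_zero (s : Bool) : hop b s f 0 = hopBoundary s f := transfer_zero ..

theorem transfer_add {ω : S → Bool → Bool → R} {τ : S → Bool → Bool → S}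
    {e : S → (ℕ → R) → R}
    (he : ∀ s f, ω s false false * e (τ s false false) (fun k => f (Nat.bit false k)) +
      ω s false true * e (τ s false true) (fun k => f (Nat.bit true k)) = e s f)
    (hadd : ∀ s f g, e s (fun k => f k + g k) = e s f + e s g) (m : ℕ) :
    ∀ (s : S) (f g : ℕ → R), transfer ω τ e m s (fun k => f k + g k) =
      transfer ω τ e m s f + transfer ω τ e m s g := by
  induction m using Nat.binaryRec' with
  | zero => intro s f g; simp [transfer_zero, hadd]
  | bit c m _ ih =>
    intro s f g
    simp only [transfer_bit he, ih]
    ring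

theorem transfer_mul {ω : S → Bool → Bool → R} {τ : S → Bool → Bool → S}
    {e : S → (ℕ → R) → R}
    (he : ∀ s f, ω s false false * e (τ s false false) (fun k => f (Nat.bit false k)) +
      ω s false true * e (τ s false true) (fun k => f (Nat.bit true k)) = e s f)
    (hmul : ∀ s a f, e s (fun k => a * f k) = a * e s f) (m : ℕ) :
    ∀ (s : S) (a : R) (f : ℕ → R), transfer ω τ e m s (fun k => a * f k) =
      a * transfer ω τ e m s f := by
  induction m using Nat.binaryRec' with
  | zero => intro s f g; simp [transfer_zero, hmul]
  | bit c m _ ih =>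
    intro s a f
    simp only [transfer_bit he, ih]
    ring

theorem vStrip_add (s : Bond) (g : ℕ → R) :
    vStrip x u s (fun k => f k + g k) m = vStrip x u s f m + vStrip x u s g m :=
  transfer_add (by rintro (_ | _ | _) f <;> simp [vWeight, vNext, boundary])
    (by rintro (_ | _ | _) f g <;> simp [boundary]) ..
theorem hStrip_add (s : Bond) (g : ℕ → R) :
    hStrip x u s (fun k => f k + g k) m = hStrip x u s f m + hStrip x u s g m :=
  transfer_add (by rintro (_ | _ | _) f <;> simp [hWeight, hNext, boundary])
    (by rintro (_ | _ | _) f g <;> simp [boundary]) ..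
theorem hop_add (s : Bool) (g : ℕ → R) :
    hop b s (fun k => f k + g k) m = hop b s f m + hop b s g m :=
  transfer_add (by rintro (_ | _) f <;> simp [hopWeight, hopNext, hopBoundary])
    (by rintro (_ | _) f g <;> simp [hopBoundary]) ..
theorem vStrip_mul (s : Bond) (a : R) :
    vStrip x u s (fun k => a * f k) m = a * vStrip x u s f m :=
  transfer_mul (by rintro (_ | _ | _) f <;> simp [vWeight, vNext, boundary])
    (by rintro (_ | _ | _) f g <;> simp [boundary]) ..
theorem hStrip_mul (s : Bond) (a : R) :
    hStrip x u s (fun k => a * f k) m = a * hStrip x u s f m :=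
  transfer_mul (by rintro (_ | _ | _) f <;> simp [hWeight, hNext, boundary])
    (by rintro (_ | _ | _) f g <;> simp [boundary]) ..
theorem hop_mul (s : Bool) (a : R) :
    hop b s (fun k => a * f k) m = a * hop b s f m :=
  transfer_mul (by rintro (_ | _) f <;> simp [hopWeight, hopNext, hopBoundary])
    (by rintro (_ | _) f g <;> simp [hopBoundary]) ..

/-! ### The intertwining relation -/

/-- The composite of a vertical and a horizontal strip, starting in the states `t` and `s`. -/
noncomputable def strips (x u : R) (s t : Bond) (f : ℕ → R) (m : ℕ) : R :=
  hStrip x u s (vStrip x u t f) m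

/-- The nine composite operators are combinations of three of them, those with states
`(blocked, free)`, `(blocked, blocked)` and `(moving, blocked)`. -/
theorem strips_relations :
    strips x u free blocked f m = strips x u blocked free f m ∧
    strips x u blocked moving f m = strips x u moving blocked f m ∧
    strips x u moving free f m = strips x u moving blocked f m ∧
    strips x u free moving f m = u * strips x u moving blocked f m ∧
    strips x u moving moving f m = 0 ∧
    strips x u free free f m = (1 + u) * strips x u blocked free f m -
      u * strips x u blocked blocked f m := by
  induction m using Nat.binaryRec' generalizing f with
  | zero => simp [strips, hStrip_zero, vStrip_zero, boundary]; ring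
  | bit c m _ ih =>
    obtain ⟨-, -, a3, -, -, a6⟩ := ih (fun k => f (Nat.bit false k))
    obtain ⟨-, b2, -, b4, b5, -⟩ := ih (fun k => f (Nat.bit true k))
    unfold strips at *
    cases c <;> simp only [hStrip_bit, vStrip_bit, hWeight, hNext, vWeight, vNext,
      hStrip_add, hStrip_mul, a3, a6, b2, b4, b5] <;>
      refine ⟨?_, ?_, ?_, ?_, ?_, ?_⟩ <;> ring

theorem strips_bit_true :
    strips x u blocked free f (Nat.bit true m) =
      u * strips x u blocked blocked (fun k => f (Nat.bit true k)) m ∧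
    strips x u blocked blocked f (Nat.bit true m) =
      strips x u blocked blocked (fun k => f (Nat.bit true k)) m ∧
    strips x u moving blocked f (Nat.bit true m) =
      strips x u blocked free (fun k => f (Nat.bit false k)) m +
        x * strips x u moving blocked (fun k => f (Nat.bit true k)) m := by
  obtain ⟨-, b2, -, -, -, -⟩ := strips_relations x u (fun k => f (Nat.bit true k)) m
  unfold strips at *
  simp only [hStrip_bit, vStrip_bit, hWeight, hNext, vWeight, vNext,
      hStrip_add, hStrip_mul, b2]
  refine ⟨?_, ?_, ?_⟩ <;> ring

theorem strips_bit_false :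
    strips x u blocked free f (Nat.bit false m) =
      (1 + u) * strips x u blocked free (fun k => f (Nat.bit false k)) m +
        -u * strips x u blocked blocked (fun k => f (Nat.bit false k)) m +
        2 * x * u * strips x u moving blocked (fun k => f (Nat.bit true k)) m ∧
    strips x u blocked blocked f (Nat.bit false m) =
      (1 + u) * strips x u blocked free (fun k => f (Nat.bit false k)) m +
        -u * strips x u blocked blocked (fun k => f (Nat.bit false k)) m +
        x * (1 + u) * strips x u moving blocked (fun k => f (Nat.bit true k)) m ∧
    strips x u moving blocked f (Nat.bit false m) =
      x * strips x u moving blocked (fun k => f (Nat.bit false k)) m := by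
  have h := strips_relations x u f (Nat.bit false m)
  obtain ⟨-, -, a3, -, -, a6⟩ := strips_relations x u (fun k => f (Nat.bit false k)) m
  obtain ⟨-, -, -, b4, b5, -⟩ := strips_relations x u (fun k => f (Nat.bit true k)) m
  rw [← h.1]
  unfold strips at *
  simp only [hStrip_bit, vStrip_bit, hWeight, hNext, vWeight, vNext,
      hStrip_add, hStrip_mul, a3, a6, b4, b5]
  refine ⟨?_, ?_, ?_⟩ <;> ring

theorem strips_zero (s t : Bond) : strips x u s t f 0 = boundary s (fun k => boundary t f) := by
  cases s <;> simp [strips, hStrip_zero, vStrip_zero, boundary]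

theorem strips_add (s t : Bond) (g : ℕ → R) :
    strips x u s t (fun k => f k + g k) m = strips x u s t f m + strips x u s t g m := by
  rw [strips, show vStrip x u t (fun k => f k + g k) =
    fun k => vStrip x u t f k + vStrip x u t g k from funext fun k => vStrip_add ..]
  exact hStrip_add ..
theorem strips_mul (s t : Bond) (a : R) :
    strips x u s t (fun k => a * f k) m = a * strips x u s t f m := by
  rw [strips, show vStrip x u t (fun k => a * f k) =
    fun k => a * vStrip x u t f k from funext fun k => vStrip_mul ..]
  exact hStrip_mul ..

/-- Commutation relations of `hop` with the three basic composites. The list is closed under reading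
one digit, so that all of them are proved by one induction. -/
theorem strips_hop (hu : u = 1 + b * x) :
    (1 + u) * strips x u moving blocked (hop b false f) m =
      hop b false (strips x u moving blocked f) m ∧
    (1 + u) * b * x * strips x u moving blocked (hop b true f) m =
      hop b false (strips x u blocked free f) m - hop b false (strips x u blocked blocked f) m ∧
    strips x u blocked blocked (hop b true f) m = hop b true (strips x u blocked blocked f) m ∧
    u * strips x u blocked blocked (hop b false f) m =
      b * x * hop b true (strips x u moving blocked f) m +
        hop b false (strips x u blocked blocked f) m ∧
    (1 + u) * strips x u blocked free (hop b false f) m =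
      b * x * hop b true (strips x u moving blocked f) m +
        hop b false (strips x u blocked blocked f) m +
        hop b false (strips x u blocked free f) m ∧
    hop b true (strips x u blocked free f) m = u * hop b true (strips x u blocked blocked f) m := by
  subst hu
  induction m using Nat.binaryRec' generalizing f with
  | zero =>
    have h1 : strips x (1 + b * x) blocked blocked f 1 = f 1 := by
      simpa [strips_zero, boundary] using (strips_bit_true x (1 + b * x) f 0).2.1
    have h2 : strips x (1 + b * x) blocked free f 1 = (1 + b * x) * f 1 := by
      simpa [strips_zero, boundary] using (strips_bit_true x (1 + b * x) f 0).1
    have h3 : strips x (1 + b * x) moving blocked f 1 = f 0 := by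
      simpa [strips_zero, boundary] using (strips_bit_true x (1 + b * x) f 0).2.2
    simp only [hop_zero, strips_zero, hopBoundary, boundary, h1, h2, h3]
    refine ⟨?_, ?_, ?_, ?_, ?_, ?_⟩ <;> first | trivial | ring
  | bit c m _ ih =>
    obtain ⟨a1, a2, a3, a4, a5, a6⟩ := ih (fun k => f (Nat.bit false k))
    obtain ⟨b1, b2, b3, b4, b5, b6⟩ := ih (fun k => f (Nat.bit true k))
    cases c <;>
      simp only [hop_bit, strips_bit_true, strips_bit_false, hopWeight, hopNext,
        strips_add, strips_mul, hop_add, hop_mul]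
    · refine ⟨?_, ?_, ?_, ?_, ?_, ?_⟩
      · linear_combination x * a1
      · linear_combination b * x ^ 2 * b1
      · linear_combination b5 - b4 - b2
      · linear_combination (1 + b * x) * (a5 - a4 + a2 + 2 * x * b1)
      · linear_combination (2 + b * x) * (a5 - a4) + (1 + b * x) * (2 * a2 + 4 * x * b1)
      · ring
    · refine ⟨?_, ?_, ?_, ?_, ?_, ?_⟩
      · linear_combination a5 + a2 + 2 * x * b1
      · linear_combination b * x * (b5 - b2)
      · linear_combination -b * b3
      · linear_combination b * (1 + b * x) * a3 + 2 * b4 - 2 * b * a6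
      · linear_combination (2 + b * x) * ((1 + b * x) * b * a3 + 2 * b4) - b * (4 + b * x) * a6
      · ring

variable {x u b}

/-- The operator adding one variable to a `Q`-generating function. The new shape may acquire one box
on the main diagonal with each of the two letters, whence the initial states `moving`. -/
noncomputable def addQ (x u : R) (f : ℕ → R) (m : ℕ) : R :=
  hStrip x u .free (fun k => vStrip x u .free f k + x * vStrip x u .moving f k) m +
    x * hStrip x u .moving (fun k => vStrip x u .free f k + x * vStrip x u .moving f k) m

/-- The operator adding one variable to a `P`-generating function. The primed letter neither adds
nor marks a box on the main diagonal, whence the initial state `blocked`. -/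
noncomputable def addP (x u : R) (f : ℕ → R) (m : ℕ) : R :=
  hStrip x u .free (vStrip x u .blocked f) m + x * hStrip x u .moving (vStrip x u .blocked f) m

theorem addQ_hop (hu : u = 1 + b * x) :
    addQ x u (hop b false f) m = hop b false (addP x u f) m := by
  obtain ⟨-, -, h3, h4, h5, h6⟩ := strips_relations x u (hop b false f) m
  obtain ⟨r1, -, -, r4, r5, -⟩ := strips_hop x u b f m hu
  have hP : addP x u f = fun k => strips x u blocked free f k +
      x * strips x u moving blocked f k := funext fun k => by
    rw [← (strips_relations x u f k).1]; rfl
  rw [hP, hop_add, hop_mul, addQ, hStrip_add, hStrip_add, hStrip_mul, hStrip_mul]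
  unfold strips at *
  linear_combination h6 + x * h4 + x * h3 + x ^ 2 * h5 + r5 - r4 + x * r1

end Transfer

/-! ### Diagonal heights -/

/-- The number of binary digits `1` of `n` in positions `≥ p`, which is the number of boxes on the
diagonal `j - i = p` of the shifted diagram encoded by `n`. -/
def height (n : ℕ) : ℕ → ℕ :=
  Nat.binaryRec (motive := fun _ => ℕ → ℕ) (fun _ => 0)
    (fun b _ ih p => match p with
      | 0 => b.toNat + ih 0
      | p + 1 => ih p) n

theorem height_zero (p : ℕ) : height 0 p = 0 := by simp [height]

theorem height_bit (b : Bool) (n p : ℕ) : height (Nat.bit b n) p = match p with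
      | 0 => b.toNat + height n 0
      | p + 1 => height n p := by
  unfold height
  rw [Nat.binaryRec_eq]
  left
  funext p
  cases p <;> rfl

theorem height_bit_zero (b : Bool) (n : ℕ) :
    height (Nat.bit b n) 0 = b.toNat + height n 0 := height_bit ..
theorem height_bit_succ (b : Bool) (n p : ℕ) :
    height (Nat.bit b n) (p + 1) = height n p := height_bit ..

theorem height_eq_testBit_add (n p : ℕ) :
    height n p = (n.testBit p).toNat + height n (p + 1) := by
  induction n using Nat.binaryRec' generalizing p with
  | zero => simp [height_zero]
  | bit b n _ ih =>
    cases p with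
    | zero => rw [height_bit_zero, height_bit_succ, Nat.testBit_bit_zero]
    | succ p => rw [height_bit_succ, height_bit_succ, Nat.testBit_bit_succ, ih]

theorem height_succ_le (n p : ℕ) : height n (p + 1) ≤ height n p := by
  rw [height_eq_testBit_add n p]; omega

theorem height_le_succ (n p : ℕ) : height n p ≤ height n (p + 1) + 1 := by
  rw [height_eq_testBit_add n p]; have := (n.testBit p).toNat_le; omega

theorem height_antitone (n : ℕ) : Antitone (height n) := antitone_nat_of_succ_le (height_succ_le n)

theorem bit_lt_two_pow_succ {b : Bool} {n N : ℕ} : Nat.bit b n < 2 ^ (N + 1) ↔ n < 2 ^ N := by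
  rw [Nat.bit_val, pow_succ]; cases b <;> simp <;> omega

theorem height_eq_zero {n N : ℕ} (h : n < 2 ^ N) {p : ℕ} (hp : N ≤ p) : height n p = 0 := by
  induction N generalizing n p with
  | zero => 
    obtain rfl : n = 0 := by simpa using h
    exact height_zero p
  | succ N ih =>
    obtain ⟨p, rfl⟩ : ∃ q, p = q + 1 := ⟨p - 1, by omega⟩
    cases n using Nat.bitCasesOn with
    | bit b n => rw [height_bit_succ]; exact ih (bit_lt_two_pow_succ.1 h) (by omega)

/-! ### Matrix entries of the strip operators -/

section ClosedForm

variable {R : Type*} [CommRing R] (x u : R)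

open Bond

/-- The indicator function of `n`. -/
def pointMass (n : ℕ) (k : ℕ) : R := if k = n then 1 else 0

theorem pointMass_bit (b : Bool) (n : ℕ) (c : Bool) :
    (fun k => pointMass (R := R) (Nat.bit b n) (Nat.bit c k)) =
      fun k => (if c = b then 1 else 0) * pointMass n k := by
  funext k
  have h : Nat.bit c k = Nat.bit b n ↔ c = b ∧ k = n := by
    rw [Nat.bit_val, Nat.bit_val]
    cases b <;> cases c <;> simp <;> omega
  simp only [pointMass, h, ite_and, ite_mul, one_mul, zero_mul]

theorem vStrip_pointMass_bit (s : Bond) (l n : Bool) (lam nu : ℕ) :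
    vStrip x u s (pointMass (Nat.bit n nu)) (Nat.bit l lam) =
      vWeight x u s l n * vStrip x u (vNext s l n) (pointMass nu) lam := by
  rw [vStrip_bit, pointMass_bit, pointMass_bit, vStrip_mul, vStrip_mul]
  cases n <;> simp

theorem hStrip_pointMass_bit (s : Bond) (l n : Bool) (lam nu : ℕ) :
    hStrip x u s (pointMass (Nat.bit n nu)) (Nat.bit l lam) =
      hWeight x u s l n * hStrip x u (hNext s l n) (pointMass nu) lam := by
  rw [hStrip_bit, pointMass_bit, pointMass_bit, hStrip_mul, hStrip_mul]
  cases n <;> simp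

/-- The number of particles crossing a bond. -/
def Bond.size : Bond → ℕ
  | moving => 1
  | _ => 0

/-- The inner shape is contained in the outer one with a vertical strip as difference, in terms of
the diagonals. -/
def VStripCond (lam nu : ℕ) : Prop :=
  ∀ p, height nu p ≤ height lam p ∧ height lam (p + 1) ≤ height nu p

/-- The inner shape is contained in the outer one with a horizontal strip as difference, in terms of
the diagonals. -/
def HStripCond (lam nu : ℕ) : Prop :=
  ∀ p, height nu p ≤ height lam p ∧ height lam p ≤ height nu (p + 1) + 1

/-- The last box of `nu` on the diagonal `p` may be marked with a primed letter: there is no box of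
`lam` to its right and no box of `nu` below it. On the main diagonal the state `s` decides. -/
def VCorner (s : Bond) (lam nu p : ℕ) : Prop :=
  height lam (p + 1) + 1 ≤ height nu p ∧
    match p with
    | 0 => s = free
    | p + 1 => height nu p ≤ height nu (p + 1)

/-- The last box of `nu` on the diagonal `p` may be marked with an unprimed letter: there is no box
of `nu` to its right and no box of `lam` below it. On the main diagonal the state `s` decides. -/
def HCorner (s : Bond) (lam nu p : ℕ) : Prop :=
  height nu (p + 1) + 1 ≤ height nu p ∧
    match p with
    | 0 => s = free
    | p + 1 => height lam p ≤ height nu (p + 1)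

open Classical in
theorem vStrip_pointMass {N : ℕ} : ∀ (s : Bond) {lam nu : ℕ}, lam < 2 ^ N → nu < 2 ^ N →
    vStrip x u s (pointMass nu) lam =
      if height lam 0 = height nu 0 + s.size ∧ VStripCond lam nu then
        ∏ p ∈ Finset.range N, (x ^ (height lam (p + 1) - height nu (p + 1)) *
          if VCorner s lam nu p then u else 1)
      else 0 := by
  induction N with
  | zero =>
    intro s lam nu hl hn
    obtain rfl : lam = 0 := by simpa using hl
    obtain rfl : nu = 0 := by simpa using hn
    cases s <;> simp [vStrip_zero, boundary, pointMass, height_zero, VStripCond, Bond.size]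
  | succ N ih =>
    intro s lam nu hl hn
    cases lam using Nat.bitCasesOn with
    | bit l lam =>
    cases nu using Nat.bitCasesOn with
    | bit n nu =>
    rw [vStrip_pointMass_bit, ih _ (bit_lt_two_pow_succ.1 hl) (bit_lt_two_pow_succ.1 hn),
      Finset.prod_range_succ']
    have hV : VStripCond (Nat.bit l lam) (Nat.bit n nu) ↔
        (n.toNat + height nu 0 ≤ l.toNat + height lam 0 ∧
          height lam 0 ≤ n.toNat + height nu 0) ∧ VStripCond lam nu := by
      rw [VStripCond, ← Nat.and_forall_add_one]
      simp only [height_bit_zero, height_bit_succ, VStripCond]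
    rw [hV]
    by_cases hS : VStripCond lam nu
    swap
    · simp [hS]
    have h1 := hS 0
    have h2 := height_succ_le lam 0
    have h3 := height_le_succ lam 0
    have h4 := height_succ_le nu 0
    simp only [hS, and_true, height_bit_zero, height_bit_succ]
    by_cases hh : height lam 0 = height nu 0 + (vNext s l n).size
    · have hprod : ∏ k ∈ Finset.range N, (x ^ (height lam (k + 1) - height nu (k + 1)) *
            if VCorner s (Nat.bit l lam) (Nat.bit n nu) (k + 1) then u else 1) =
          ∏ k ∈ Finset.range N, (x ^ (height lam (k + 1) - height nu (k + 1)) *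
            if VCorner (vNext s l n) lam nu k then u else 1) := by
        refine Finset.prod_congr rfl fun k _ => ?_
        congr 2
        cases k with
        | zero =>
          simp only [VCorner, height_bit_zero, height_bit_succ]
          cases s <;> cases l <;> cases n <;> simp [vNext, Bond.size] at hh ⊢
        | succ k => simp only [VCorner, height_bit_succ]
      rw [hprod, if_pos hh]
      have hc : VCorner s (Nat.bit l lam) (Nat.bit n nu) 0 ↔ 
          height lam 0 + 1 ≤ n.toNat + height nu 0 ∧ s = free := by
        simp only [VCorner, height_bit_zero, height_bit_succ]
      rw [hc]
      cases s <;> cases l <;> cases n <;> simp [vNext, Bond.size, vWeight] at hh ⊢ <;> simp [hh]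
      all_goals first
        | (intro h; exfalso; omega)
        | (split_ifs <;> first | (exfalso; omega) | ring)
        | ring
    · rw [if_neg hh, mul_zero, if_neg]
      cases s <;> cases l <;> cases n <;> simp [vNext, Bond.size] at hh ⊢ <;> omega

open Classical in
theorem hStrip_pointMass {N : ℕ} : ∀ (s : Bond) {lam nu : ℕ}, lam < 2 ^ N → nu < 2 ^ N →
    hStrip x u s (pointMass nu) lam =
      if height lam 0 = height nu 0 + s.size ∧ HStripCond lam nu then
        ∏ p ∈ Finset.range N, (x ^ (height lam (p + 1) - height nu (p + 1)) *
          if HCorner s lam nu p then u else 1)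
      else 0 := by
  induction N with
  | zero =>
    intro s lam nu hl hn
    obtain rfl : lam = 0 := by simpa using hl
    obtain rfl : nu = 0 := by simpa using hn
    cases s <;> simp [hStrip_zero, boundary, pointMass, height_zero, HStripCond, Bond.size]
  | succ N ih =>
    intro s lam nu hl hn
    cases lam using Nat.bitCasesOn with
    | bit l lam =>
    cases nu using Nat.bitCasesOn with
    | bit n nu =>
    rw [hStrip_pointMass_bit, ih _ (bit_lt_two_pow_succ.1 hl) (bit_lt_two_pow_succ.1 hn),
      Finset.prod_range_succ']
    have hV : HStripCond (Nat.bit l lam) (Nat.bit n nu) ↔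
        (n.toNat + height nu 0 ≤ l.toNat + height lam 0 ∧
          l.toNat + height lam 0 ≤ height nu 0 + 1) ∧ HStripCond lam nu := by
      rw [HStripCond, ← Nat.and_forall_add_one]
      simp only [height_bit_zero, height_bit_succ, HStripCond]
    rw [hV]
    by_cases hS : HStripCond lam nu
    swap
    · simp [hS]
    have h1 := hS 0
    have h2 := height_succ_le lam 0
    have h3 := height_le_succ lam 0
    have h4 := height_succ_le nu 0
    simp only [hS, and_true, height_bit_zero, height_bit_succ]
    by_cases hh : height lam 0 = height nu 0 + (hNext s l n).size
    · have hprod : ∏ k ∈ Finset.range N, (x ^ (height lam (k + 1) - height nu (k + 1)) *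
            if HCorner s (Nat.bit l lam) (Nat.bit n nu) (k + 1) then u else 1) =
          ∏ k ∈ Finset.range N, (x ^ (height lam (k + 1) - height nu (k + 1)) *
            if HCorner (hNext s l n) lam nu k then u else 1) := by
        refine Finset.prod_congr rfl fun k _ => ?_
        congr 2
        cases k with
        | zero =>
          simp only [HCorner, height_bit_zero, height_bit_succ]
          cases s <;> cases l <;> cases n <;> simp [hNext, Bond.size] at hh ⊢ <;> omega
        | succ k => simp only [HCorner, height_bit_succ]
      rw [hprod, if_pos hh]
      have hc : HCorner s (Nat.bit l lam) (Nat.bit n nu) 0 ↔ 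
          height nu 0 + 1 ≤ n.toNat + height nu 0 ∧ s = free := by
        simp only [HCorner, height_bit_zero, height_bit_succ]
      rw [hc]
      cases s <;> cases l <;> cases n <;> simp [hNext, Bond.size, hWeight] at hh ⊢ <;> simp [hh]
      all_goals first
        | (intro h; exfalso; omega)
        | (split_ifs <;> first | (exfalso; omega) | ring)
        | ring
    · rw [if_neg hh, mul_zero, if_neg]
      cases s <;> cases l <;> cases n <;> simp [hNext, Bond.size] at hh ⊢ <;> omega

end ClosedForm

/-! ### Expansion in matrix entries -/

section Expansion

variable {R : Type*} [CommRing R] (x u : R)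

open Bond

theorem vStrip_congr {N : ℕ} : ∀ (s : Bond) {f g : ℕ → R} {lam : ℕ}, lam < 2 ^ N →
    (∀ k < 2 ^ N, f k = g k) → vStrip x u s f lam = vStrip x u s g lam := by
  induction N with
  | zero =>
    intro s f g lam hl h
    obtain rfl : lam = 0 := by simpa using hl
    cases s <;> simp [vStrip_zero, boundary, h]
  | succ N ih =>
    intro s f g lam hl h
    cases lam using Nat.bitCasesOn with
    | bit l lam =>
    rw [vStrip_bit, vStrip_bit, ih _ (bit_lt_two_pow_succ.1 hl) (g := fun k => g (Nat.bit false k))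
        fun k hk => h _ (bit_lt_two_pow_succ.2 hk), ih _ (bit_lt_two_pow_succ.1 hl)
        (g := fun k => g (Nat.bit true k)) fun k hk => h _ (bit_lt_two_pow_succ.2 hk)]

theorem hStrip_congr {N : ℕ} : ∀ (s : Bond) {f g : ℕ → R} {lam : ℕ}, lam < 2 ^ N →
    (∀ k < 2 ^ N, f k = g k) → hStrip x u s f lam = hStrip x u s g lam := by
  induction N with
  | zero =>
    intro s f g lam hl h
    obtain rfl : lam = 0 := by simpa using hl
    cases s <;> simp [hStrip_zero, boundary, h]
  | succ N ih =>
    intro s f g lam hl h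
    cases lam using Nat.bitCasesOn with
    | bit l lam =>
    rw [hStrip_bit, hStrip_bit, ih _ (bit_lt_two_pow_succ.1 hl) (g := fun k => g (Nat.bit false k))
        fun k hk => h _ (bit_lt_two_pow_succ.2 hk), ih _ (bit_lt_two_pow_succ.1 hl)
        (g := fun k => g (Nat.bit true k)) fun k hk => h _ (bit_lt_two_pow_succ.2 hk)]

theorem eq_sum_pointMass {N k : ℕ} (f : ℕ → R) (hk : k < 2 ^ N) :
    f k = ∑ n ∈ Finset.range (2 ^ N), f n * pointMass n k := by
  simp [pointMass, hk]

theorem map_sum_mul {ι : Type*} {T : (ℕ → R) → R}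
    (hadd : ∀ f g, T (fun k => f k + g k) = T f + T g)
    (hmul : ∀ (a : R) f, T (fun k => a * f k) = a * T f) (A : Finset ι) (c : ι → R)
    (g : ι → ℕ → R) :
    T (fun k => ∑ n ∈ A, c n * g n k) = ∑ n ∈ A, c n * T (g n) := by
  classical
  induction A using Finset.induction_on with
  | empty => simpa using hmul 0 (fun _ => 0)
  | insert a A ha ih =>
    simp only [Finset.sum_insert ha]
    rw [hadd, hmul, ih]

theorem vStrip_eq_sum {N lam : ℕ} (s : Bond) (f : ℕ → R) (h : lam < 2 ^ N) :
    vStrip x u s f lam =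
      ∑ n ∈ Finset.range (2 ^ N), f n * vStrip x u s (pointMass n) lam := by
  rw [vStrip_congr x u s h fun k hk => eq_sum_pointMass f hk]
  exact map_sum_mul (fun f g => vStrip_add x u f lam s g) (fun a f => vStrip_mul x u f lam s a) ..

theorem hStrip_eq_sum {N lam : ℕ} (s : Bond) (f : ℕ → R) (h : lam < 2 ^ N) :
    hStrip x u s f lam =
      ∑ n ∈ Finset.range (2 ^ N), f n * hStrip x u s (pointMass n) lam := by
  rw [hStrip_congr x u s h fun k hk => eq_sum_pointMass f hk]
  exact map_sum_mul (fun f g => hStrip_add x u f lam s g) (fun a f => hStrip_mul x u f lam s a) ..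

end Expansion

/-! ### Diagrams -/

theorem lt_of_lt_height {n p i : ℕ} (h : i < height n p) : p < n := by
  by_contra hp
  rw [height_eq_zero (Nat.lt_two_pow_self (n := n)) (by omega)] at h
  omega

/-- The shifted diagram of the strict partition encoded by `n`, diagonal by diagonal. -/
def diagram (n : ℕ) : Finset (ℕ × ℕ) :=
  (Finset.range n).biUnion fun p => (Finset.range (height n p)).image fun i => (i, i + p)

theorem mem_diagram {n i j : ℕ} : (i, j) ∈ diagram n ↔ i ≤ j ∧ i < height n (j - i) := by
  simp only [diagram, Finset.mem_biUnion, Finset.mem_range, Finset.mem_image, Prod.mk.injEq]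
  constructor
  · rintro ⟨p, -, i', h, rfl, rfl⟩
    simpa using h
  · rintro ⟨h1, h2⟩
    exact ⟨j - i, lt_of_lt_height h2, i, h2, rfl, by omega⟩

theorem mem_diagram_add {n i p : ℕ} : (i, i + p) ∈ diagram n ↔ i < height n p := by
  simp [mem_diagram]

theorem mem_diagram_of_le {n i j i' j' : ℕ} (h : (i', j') ∈ diagram n) (hij : i ≤ j)
    (hi : i ≤ i') (hj : j ≤ j') : (i, j) ∈ diagram n := by
  rw [mem_diagram] at *
  refine ⟨hij, ?_⟩
  obtain ⟨h1, h2⟩ := h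
  by_cases hc : j - i ≤ j' - i'
  · exact (hi.trans_lt h2).trans_le (height_antitone n hc)
  · -- moving up by one row costs at most one diagonal
    have key : ∀ k, height n (j' - i') ≤ height n (j' - i' + k) + k := by
      intro k
      induction k with
      | zero => simp
      | succ k ih => have := height_le_succ n (j' - i' + k); rw [add_assoc] at this; omega
    have := key ((j - i) - (j' - i'))
    rw [Nat.add_sub_cancel' (by omega)] at this
    omega

theorem diagram_subset_iff {lam nu : ℕ} :
    diagram nu ⊆ diagram lam ↔ ∀ p, height nu p ≤ height lam p := by
  constructor
  · intro h p
    by_contra hp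
    push Not at hp
    exact lt_irrefl _ (mem_diagram_add.1 (h (mem_diagram_add.2 hp)))
  · rintro h ⟨i, j⟩ hc
    rw [mem_diagram] at *
    exact ⟨hc.1, hc.2.trans_le (h _)⟩

theorem diagram_injective : Function.Injective diagram := by
  intro m n h
  have hh : height m = height n := funext fun p =>
    le_antisymm (diagram_subset_iff.1 h.subset p) (diagram_subset_iff.1 h.symm.subset p)
  refine Nat.eq_of_testBit_eq fun p => ?_
  have h1 := height_eq_testBit_add m p
  have h2 := height_eq_testBit_add n p
  rw [hh] at h1
  cases hm : m.testBit p <;> cases hn : n.testBit p <;> simp [hm, hn] at h1 h2 ⊢ <;> omega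

theorem card_diagram {n N : ℕ} (h : n < 2 ^ N) :
    (diagram n).card = ∑ p ∈ Finset.range N, height n p := by
  have : diagram n = (Finset.range N).biUnion fun p =>
      (Finset.range (height n p)).image fun i => (i, i + p) := by
    ext ⟨i, j⟩
    rw [mem_diagram]
    simp only [Finset.mem_biUnion, Finset.mem_range, Finset.mem_image, Prod.mk.injEq]
    constructor
    · rintro ⟨h1, h2⟩
      refine ⟨j - i, ?_, i, h2, rfl, by omega⟩
      by_contra hp
      rw [height_eq_zero h (by omega)] at h2
      omega
    · rintro ⟨p, -, i', h, rfl, rfl⟩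
      simpa using h
  rw [this, Finset.card_biUnion]
  · refine Finset.sum_congr rfl fun p _ => ?_
    rw [Finset.card_image_of_injective _ fun a b hab => (Prod.mk.inj hab).1, Finset.card_range]
  · intro p _ q _ hpq
    simp only [Finset.disjoint_left, Finset.mem_image, Finset.mem_range]
    rintro _ ⟨i, -, rfl⟩ ⟨i', -, h'⟩
    simp only [Prod.mk.injEq] at h'
    omega

theorem card_diagram_sdiff {lam nu N : ℕ} (hl : lam < 2 ^ N) (hn : nu < 2 ^ N)
    (h : diagram nu ⊆ diagram lam) : (diagram lam \ diagram nu).card =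
      ∑ p ∈ Finset.range N, (height lam p - height nu p) := by
  rw [Finset.card_sdiff_of_subset h, card_diagram hl, card_diagram hn,
    Finset.sum_tsub_distrib _ fun p _ => diagram_subset_iff.1 h p]

/-! ### One letter as an operator -/

/-- The neighbour of a box that cannot contain the letter `a` as well: the box to the right if `a`
is primed, the box below if it is unprimed. -/
def nbr (a : ℕ) (c : ℕ × ℕ) : ℕ × ℕ := if Even a then (c.1, c.2 + 1) else (c.1 + 1, c.2)

/-- The other neighbour: the box below if `a` is primed, the box to the right if it is unprimed. -/
def nbr' (a : ℕ) (c : ℕ × ℕ) : ℕ × ℕ := if Even a then (c.1 + 1, c.2) else (c.1, c.2 + 1)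

/-- The letter `a` may stand in the box `c`, in `Q`-tableaux (`q = true`) or `P`-tableaux
(`q = false`): the latter have no primed letters on the diagonal. -/
def Allowed (q : Bool) (a : ℕ) (c : ℕ × ℕ) : Prop := q = false → Even a → c.1 ≠ c.2

/-- All boxes of `lam / nu` can be filled with the letter `a`. -/
def IsStrip (q : Bool) (a lam nu : ℕ) : Prop :=
  diagram nu ⊆ diagram lam ∧
    ∀ c ∈ diagram lam, c ∉ diagram nu → nbr a c ∉ diagram lam ∧ Allowed q a c

open Classical in
/-- The boxes of `nu` to which the letter `a` can be added when the boxes of `lam / nu` contain `a`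
and all other letters are smaller than `a`. -/
noncomputable def corners (q : Bool) (a lam nu : ℕ) : Finset (ℕ × ℕ) :=
  (diagram nu).filter fun c => nbr a c ∉ diagram lam ∧ nbr' a c ∉ diagram nu ∧ Allowed q a c

theorem vStripCond_iff {lam nu : ℕ} : VStripCond lam nu ↔ diagram nu ⊆ diagram lam ∧
    ∀ c ∈ diagram lam, c ∉ diagram nu → (c.1, c.2 + 1) ∉ diagram lam := by
  rw [diagram_subset_iff]
  constructor
  · refine fun h => ⟨fun p => (h p).1, ?_⟩
    rintro ⟨i, j⟩ hc hn hr
    rw [mem_diagram] at *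
    have := (h (j - i)).2
    rw [show j + 1 - i = j - i + 1 by omega] at hr
    omega
  · refine fun h p => ⟨h.1 p, ?_⟩
    by_contra hp
    refine h.2 (height nu p, height nu p + p) ?_ ?_ ?_
    · have := height_succ_le lam p
      rw [mem_diagram_add]; omega
    · rw [mem_diagram_add]; omega
    · show (height nu p, height nu p + (p + 1)) ∈ _
      rw [mem_diagram_add]; omega

theorem hStripCond_iff {lam nu : ℕ} : HStripCond lam nu ↔ diagram nu ⊆ diagram lam ∧
    ∀ c ∈ diagram lam, c ∉ diagram nu → (c.1 + 1, c.2) ∉ diagram lam := by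
  rw [diagram_subset_iff]
  constructor
  · refine fun h => ⟨fun p => (h p).1, ?_⟩
    rintro ⟨i, j⟩ hc hn hr
    rw [mem_diagram] at *
    dsimp only at hr
    have := (h (j - (i + 1))).2
    rw [show j - (i + 1) + 1 = j - i by omega] at this
    omega
  · refine fun h p => ⟨h.1 p, ?_⟩
    by_contra hp
    refine h.2 (height nu (p + 1), height nu (p + 1) + (p + 1)) ?_ ?_ ?_
    · have := height_le_succ lam p
      rw [mem_diagram_add]; omega
    · rw [mem_diagram_add]; omega
    · show (height nu (p + 1) + 1, height nu (p + 1) + (p + 1)) ∈ _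
      rw [show height nu (p + 1) + (p + 1) = height nu (p + 1) + 1 + p by omega, mem_diagram_add]
      omega

section Step

variable {R : Type*} [CommRing R] (x u : R)

open Bond

/-- The state in which the transducer of the letter `a` starts. -/
def startBond (q : Bool) (a : ℕ) : Bond := if q = false ∧ Even a then blocked else free

open Classical in
theorem mem_corners_iff {q : Bool} {a lam nu i p : ℕ} (h : diagram nu ⊆ diagram lam) :
    (i, i + p) ∈ corners q a lam nu ↔ height nu p = i + 1 ∧
      if Even a then VCorner (startBond q a) lam nu p else HCorner (startBond q a) lam nu p := by
  have h0 := diagram_subset_iff.1 h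
  have h1 := h0 p
  have h2 := h0 (p + 1)
  have h3 := height_succ_le nu p
  have h4 := height_le_succ nu p
  have h5 : ∀ n, (i, i + p + 1) ∈ diagram n ↔ i < height n (p + 1) := fun n => by
    rw [add_assoc, mem_diagram_add]
  rw [corners, Finset.mem_filter, mem_diagram_add]
  by_cases ha : Even a <;> simp only [nbr, nbr', ha, if_true, if_false, h5, Allowed, startBond] <;>
    cases p with
  | zero =>
    have h6 : ∀ n, (i + 1, i) ∉ diagram n := fun n hn => by
      rw [mem_diagram] at hn; omega
    cases q <;> simp [VCorner, HCorner, h6] <;> simp only [zero_add] at h2 h3 h4 <;> omega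
  | succ p =>
    have h6 : ∀ n, (i + 1, i + (p + 1)) ∈ diagram n ↔ i + 1 < height n p := fun n => by
      rw [show i + (p + 1) = i + 1 + p by omega, mem_diagram_add]
    simp [VCorner, HCorner, h6] <;> omega

open Classical in
theorem prod_corners {q : Bool} {a lam nu N : ℕ} (hn : nu < 2 ^ N) (h : diagram nu ⊆ diagram lam) :
    ∏ p ∈ Finset.range N, (if (if Even a then VCorner (startBond q a) lam nu p
      else HCorner (startBond q a) lam nu p) then u else 1) = u ^ (corners q a lam nu).card := by
  rw [Finset.prod_ite, Finset.prod_const, Finset.prod_const_one, mul_one]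
  congr 1
  refine (Finset.card_nbij' (fun c => c.2 - c.1) (fun p => (height nu p - 1, height nu p - 1 + p))
    ?_ ?_ ?_ ?_).symm
  · rintro ⟨i, j⟩ hc
    have hm := mem_diagram.1 (Finset.mem_filter.1 hc).1
    obtain ⟨p, rfl⟩ := Nat.exists_eq_add_of_le hm.1
    have := (mem_corners_iff h).1 hc
    simp only [Finset.coe_filter, Finset.mem_range, Set.mem_ofPred_eq, add_tsub_cancel_left]
    refine ⟨?_, this.2⟩
    by_contra hp
    rw [height_eq_zero hn (by omega)] at this
    omega
  · intro p hp
    simp only [Finset.coe_filter, Finset.mem_range, Set.mem_ofPred_eq] at hp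
    refine (mem_corners_iff h).2 ⟨?_, hp.2⟩
    have : 1 ≤ height nu p := by
      have := hp.2
      split_ifs at this
      · have := this.1; omega
      · have := this.1; omega
    omega
  · rintro ⟨i, j⟩ hc
    have hm := mem_diagram.1 (Finset.mem_filter.1 hc).1
    obtain ⟨p, rfl⟩ := Nat.exists_eq_add_of_le hm.1
    have := (mem_corners_iff h).1 hc
    simp [this.1]
  · intro p hp
    simp

/-- The operator that adds the letter `a` with variable `x`. Unless `a` is primed and `P`-tableaux
are considered, a new box on the main diagonal is possible and costs a factor `x`. -/
noncomputable def letterStep (q : Bool) (a : ℕ) (f : ℕ → R) (lam : ℕ) : R :=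
  if Even a then
    if q then vStrip x u free f lam + x * vStrip x u moving f lam
    else vStrip x u blocked f lam
  else hStrip x u free f lam + x * hStrip x u moving f lam

theorem letterStep_eq_sum {N lam : ℕ} (q : Bool) (a : ℕ) (f : ℕ → R) (h : lam < 2 ^ N) :
    letterStep x u q a f lam =
      ∑ n ∈ Finset.range (2 ^ N), f n * letterStep x u q a (pointMass n) lam := by
  unfold letterStep
  split_ifs
  · rw [vStrip_eq_sum x u _ f h, vStrip_eq_sum x u _ f h, Finset.mul_sum, ← Finset.sum_add_distrib]
    exact Finset.sum_congr rfl fun _ _ => by ring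
  · rw [vStrip_eq_sum x u _ f h]
  · rw [hStrip_eq_sum x u _ f h, hStrip_eq_sum x u _ f h, Finset.mul_sum, ← Finset.sum_add_distrib]
    exact Finset.sum_congr rfl fun _ _ => by ring

theorem isStrip_iff {q : Bool} {a lam nu : ℕ} : IsStrip q a lam nu ↔
    (if Even a then VStripCond lam nu else HStripCond lam nu) ∧
      (q = false → Even a → height lam 0 ≤ height nu 0) := by
  have hdiag : diagram nu ⊆ diagram lam →
      ((∀ c ∈ diagram lam, c ∉ diagram nu → Allowed q a c) ↔
        (q = false → Even a → height lam 0 ≤ height nu 0)) := fun hsub => by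
    constructor
    · intro h hq ha
      by_contra hlt
      exact h (height nu 0, height nu 0 + 0) (mem_diagram_add.2 (by omega))
        (fun hc => lt_irrefl _ (mem_diagram_add.1 hc)) hq ha rfl
    · rintro h ⟨i, j⟩ hc hn hq ha (rfl : i = j)
      have := h hq ha
      rw [mem_diagram, Nat.sub_self] at *
      omega
  have hsplit : IsStrip q a lam nu ↔ (diagram nu ⊆ diagram lam ∧
      ∀ c ∈ diagram lam, c ∉ diagram nu → nbr a c ∉ diagram lam) ∧
      (∀ c ∈ diagram lam, c ∉ diagram nu → Allowed q a c) :=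
    ⟨fun h => ⟨⟨h.1, fun c h1 h2 => (h.2 c h1 h2).1⟩, fun c h1 h2 => (h.2 c h1 h2).2⟩,
      fun h => ⟨h.1.1, fun c h1 h2 => ⟨h.1.2 c h1 h2, h.2 c h1 h2⟩⟩⟩
  rw [hsplit]
  by_cases ha : Even a
  · simp only [nbr, ha, if_true, vStripCond_iff]
    exact and_congr_right fun h => by simpa [ha] using hdiag h.1
  · simp only [nbr, ha, if_false, hStripCond_iff]
    exact and_congr_right fun h => by simpa [ha] using hdiag h.1

theorem pow_card_sdiff {lam nu N : ℕ} (hl : lam < 2 ^ N) (hn : nu < 2 ^ N)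
    (h : diagram nu ⊆ diagram lam) : x ^ (diagram lam \ diagram nu).card =
      x ^ (height lam 0 - height nu 0) *
        ∏ p ∈ Finset.range N, x ^ (height lam (p + 1) - height nu (p + 1)) := by
  have h2 : 2 ^ N ≤ 2 ^ (N + 1) := Nat.pow_le_pow_right (by norm_num) (by omega)
  rw [card_diagram_sdiff (hl.trans_le h2) (hn.trans_le h2) h, Finset.sum_range_succ', add_comm,
    pow_add, Finset.prod_pow_eq_pow_sum]

open Classical in
/-- The matrix entries of the operator of one letter count the ways to add this letter. -/
theorem letterStep_pointMass {N lam nu : ℕ} (q : Bool) (a : ℕ) (hl : lam < 2 ^ N)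
    (hn : nu < 2 ^ N) : letterStep x u q a (pointMass nu) lam =
      if IsStrip q a lam nu then
        x ^ (diagram lam \ diagram nu).card * u ^ (corners q a lam nu).card
      else 0 := by
  unfold letterStep
  rw [vStrip_pointMass x u _ hl hn, vStrip_pointMass x u _ hl hn, vStrip_pointMass x u _ hl hn,
    hStrip_pointMass x u _ hl hn, hStrip_pointMass x u _ hl hn]
  by_cases hI : IsStrip q a lam nu
  swap
  · rw [if_neg hI]
    rw [isStrip_iff] at hI
    by_cases ha : Even a <;> cases q <;> simp [ha, Bond.size] at hI ⊢
    · intro h1 h2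
      exact absurd h1 (by have := hI h2; omega)
    · simp [hI]
    · simp [hI]
    · simp [hI]
  · rw [if_pos hI, pow_card_sdiff x hl hn hI.1, ← prod_corners u hn hI.1, mul_assoc,
      ← Finset.prod_mul_distrib]
    have hI' := isStrip_iff.1 hI
    -- with a new box on the main diagonal, the last old one there is not a corner in any case
    have hm : ∀ p, height lam 0 = height nu 0 + 1 → Even a →
        (VCorner moving lam nu p ↔ VCorner free lam nu p) := by
      intro p h1 ha
      cases p with
      | zero =>
        have h3 := height_le_succ lam 0
        simp only [VCorner]
        constructor <;> intro h <;> omega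
      | succ p => rfl
    have hm' : ∀ p, height lam 0 = height nu 0 + 1 → ¬ Even a →
        (HCorner moving lam nu p ↔ HCorner free lam nu p) := by
      intro p h1 ha
      rw [if_neg ha] at hI'
      cases p with
      | zero =>
        have h3 := hI'.1 0
        simp only [HCorner]
        constructor <;> intro h <;> omega
      | succ p => rfl
    have h0 := diagram_subset_iff.1 hI.1 0
    by_cases ha : Even a
    · simp only [ha, if_true, startBond, and_true] at hI' ⊢
      have h1 := hI'.1 0
      have h2 := height_le_succ lam 0
      by_cases hd : height lam 0 = height nu 0
      · cases q <;> simp [hd, Bond.size, hI'.1]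
      · have hd' : height lam 0 = height nu 0 + 1 := by omega
        cases q
        · exact absurd (hI'.2 rfl trivial) (by omega)
        · simp [hd', Bond.size, hI'.1, hm _ hd' ha]
    · simp only [ha, if_false, and_false, startBond] at hI' ⊢
      have h1 := hI'.1 0
      have h2 := height_succ_le nu 0
      by_cases hd : height lam 0 = height nu 0
      · simp [hd, Bond.size, hI'.1]
      · have hd' : height lam 0 = height nu 0 + 1 := by omega
        simp [hd', Bond.size, hI'.1, hm' _ hd' ha]

end Step

theorem lt_two_pow_of_height_eq_zero {n N : ℕ} (h : height n N = 0) : n < 2 ^ N := by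
  refine Nat.lt_pow_two_of_testBit n fun i hi => ?_
  have h1 := height_eq_testBit_add n i
  have h2 := height_antitone n hi
  cases hb : n.testBit i
  · rfl
  · simp [hb] at h1; omega

/-- Every lower set of boxes on or above the main diagonal is a shifted diagram. -/
theorem exists_diagram_eq {I : Finset (ℕ × ℕ)} (h1 : ∀ i j, (i, j) ∈ I → i ≤ j)
    (h2 : ∀ i j i' j', (i', j') ∈ I → i ≤ j → i ≤ i' → j ≤ j' → (i, j) ∈ I) :
    ∃ n, diagram n = I := by
  obtain ⟨N, hN⟩ : ∃ N, ∀ c ∈ I, c.2 - c.1 < N :=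
    ⟨I.sup (fun c => c.2 - c.1) + 1, fun c hc =>
      Nat.lt_succ_of_le (Finset.le_sup (f := fun c : ℕ × ℕ => c.2 - c.1) hc)⟩
  induction N generalizing I with
  | zero =>
    refine ⟨0, ?_⟩
    ext c
    simp only [diagram, Finset.range_zero, Finset.biUnion_empty, Finset.notMem_empty, false_iff]
    exact fun hc => absurd (hN c hc) (by omega)
  | succ N ih =>
    classical
    -- the diagonals other than the main one
    let I' : Finset (ℕ × ℕ) := (I.filter fun c => c.1 < c.2).image fun c => (c.1, c.2 - 1)
    have hI' : ∀ i j, (i, j) ∈ I' ↔ i ≤ j ∧ (i, j + 1) ∈ I := by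
      intro i j
      simp only [I', Finset.mem_image, Finset.mem_filter, Prod.mk.injEq, Prod.exists]
      constructor
      · rintro ⟨i', j', ⟨hc, hlt⟩, rfl, rfl⟩
        exact ⟨by omega, by rwa [Nat.sub_add_cancel (by omega)]⟩
      · rintro ⟨hij, hc⟩
        exact ⟨i, j + 1, ⟨hc, by omega⟩, rfl, rfl⟩
    obtain ⟨n, hn⟩ := ih (I := I') (fun i j h => ((hI' i j).1 h).1)
      (fun i j i' j' h hij hi hj =>
        (hI' i j).2 ⟨hij, h2 _ _ _ _ ((hI' i' j').1 h).2 (by omega) hi (by omega)⟩)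
      (fun ⟨i, j⟩ hc => by have := hN _ ((hI' i j).1 hc).2; have := ((hI' i j).1 hc).1; grind)
    have hmem : ∀ i p, i < height n p ↔ (i, i + p + 1) ∈ I := fun i p => by
      rw [← mem_diagram_add, hn, hI']
      exact ⟨fun h => h.2, fun h => ⟨by omega, h⟩⟩
    refine ⟨Nat.bit (decide ((height n 0, height n 0) ∈ I)) n, ?_⟩
    ext ⟨i, j⟩
    by_cases hij : i ≤ j
    swap
    · exact iff_of_false (fun h => hij (mem_diagram.1 h).1) fun h => hij (h1 _ _ h)
    obtain ⟨p, rfl⟩ := Nat.exists_eq_add_of_le hij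
    rw [mem_diagram_add]
    cases p with
    | succ p => rw [height_bit_succ, hmem]; rfl
    | zero =>
      rw [height_bit_zero, add_zero]
      rcases lt_trichotomy i (height n 0) with h | h | h
      · exact iff_of_true (by omega)
          (h2 _ _ _ _ ((hmem i 0).1 h) le_rfl le_rfl (by omega))
      · subst h
        by_cases hb : (height n 0, height n 0) ∈ I <;> simp [hb]
      · refine iff_of_false ?_ fun hc => ?_
        · have := Bool.toNat_le (decide ((height n 0, height n 0) ∈ I)); omega
        · exact lt_irrefl _ ((hmem (height n 0) 0).2
            (h2 _ _ _ _ hc (by omega) (by omega) (by omega)))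

/-! ### Tableaux with bounded entries -/

/-- The set-valued shifted tableaux with shape `D` and letters `< a`: the `Q`-tableaux if `q = true`
and the `P`-tableaux if `q = false`. -/
structure IsTableau (q : Bool) (a : ℕ) (D : Finset (ℕ × ℕ)) (T : ℕ × ℕ → Finset ℕ) : Prop where
  nonempty : ∀ c ∈ D, (T c).Nonempty
  eq_empty : ∀ c, c ∉ D → T c = ∅
  row_weak : ∀ i j j', j < j' → ∀ a ∈ T (i, j), ∀ b ∈ T (i, j'), a ≤ b
  col_weak : ∀ i i' j, i < i' → ∀ a ∈ T (i, j), ∀ b ∈ T (i', j), a ≤ b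
  col_unprimed : ∀ a, Odd a → ∀ i i' j, a ∈ T (i, j) → a ∈ T (i', j) → i = i'
  row_primed : ∀ a, Even a → ∀ i j j', a ∈ T (i, j) → a ∈ T (i, j') → j = j'
  allowed : ∀ c, ∀ e ∈ T c, Allowed q e c
  lt : ∀ c, ∀ e ∈ T c, e < a

theorem IsTableau.mem {q : Bool} {a : ℕ} {D : Finset (ℕ × ℕ)} {T : ℕ × ℕ → Finset ℕ}
    (hT : IsTableau q a D T) {c : ℕ × ℕ} {e : ℕ} (he : e ∈ T c) : c ∈ D := by
  by_contra hc
  rw [hT.eq_empty c hc] at he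
  exact Finset.notMem_empty _ he

theorem finite_isTableau (q : Bool) (a : ℕ) (D : Finset (ℕ × ℕ)) :
    {T | IsTableau q a D T}.Finite := by
  classical
  let r : (ℕ × ℕ → Finset ℕ) → (D → Finset ℕ) := fun T c => T c
  refine Set.Finite.of_finite_image (f := r) ?_ ?_
  · refine (Set.Finite.pi' (t := fun _ => ((Finset.range a).powerset : Set (Finset ℕ)))
      fun _ => Finset.finite_toSet _).subset ?_
    rintro _ ⟨T, hT, rfl⟩ c
    simp only [r, Finset.coe_powerset, Set.mem_preimage, Set.mem_powerset_iff, Finset.coe_subset]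
    exact fun e he => Finset.mem_range.2 (hT.lt _ e he)
  · intro T hT T' hT' h
    funext c
    by_cases hc : c ∈ D
    · exact congrFun h ⟨c, hc⟩
    · rw [hT.eq_empty c hc, hT'.eq_empty c hc]

/-- The finite set of tableaux with letters `< a` whose shape is encoded by `n`. -/
noncomputable def tableaux (q : Bool) (a n : ℕ) : Finset (ℕ × ℕ → Finset ℕ) :=
  (finite_isTableau q a (diagram n)).toFinset

theorem mem_tableaux {q : Bool} {a n : ℕ} {T : ℕ × ℕ → Finset ℕ} :
    T ∈ tableaux q a n ↔ IsTableau q a (diagram n) T := by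
  simp [tableaux]

/-- The filling `T` with the letter `a` added to the boxes in `M`. -/
def adjoin (a : ℕ) (M : Finset (ℕ × ℕ)) (T : ℕ × ℕ → Finset ℕ) (c : ℕ × ℕ) : Finset ℕ :=
  T c ∪ if c ∈ M then {a} else ∅

theorem mem_adjoin {a e : ℕ} {M : Finset (ℕ × ℕ)} {T : ℕ × ℕ → Finset ℕ} {c : ℕ × ℕ} :
    e ∈ adjoin a M T c ↔ e ∈ T c ∨ e = a ∧ c ∈ M := by
  unfold adjoin
  split_ifs with h <;> simp [h, or_comm]

section Adjoin

variable {q : Bool} {a lam nu : ℕ} {T : ℕ × ℕ → Finset ℕ} {O : Finset (ℕ × ℕ)}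

/-- The neighbours of the boxes that receive the letter `a`. -/
theorem nbr_notMem (hS : IsStrip q a lam nu) (hO : O ⊆ corners q a lam nu) {c : ℕ × ℕ}
    (hc : c ∈ (diagram lam \ diagram nu) ∪ O) :
    c ∈ diagram lam ∧ nbr a c ∉ diagram lam ∧ nbr a c ∉ diagram nu ∧ nbr' a c ∉ diagram nu ∧
      Allowed q a c := by
  rcases Finset.mem_union.1 hc with hc | hc
  · obtain ⟨h1, h2⟩ := Finset.mem_sdiff.1 hc
    obtain ⟨h3, h4⟩ := hS.2 c h1 h2
    have h5 := (mem_diagram.1 h1).1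
    refine ⟨h1, h3, fun h => h3 (hS.1 h), fun h => h2 ?_, h4⟩
    unfold nbr' at h
    split_ifs at h
    · exact mem_diagram_of_le h h5 (by omega) le_rfl
    · exact mem_diagram_of_le h h5 le_rfl (by omega)
  · obtain ⟨h1, h2, h3, h4⟩ := by simpa only [corners, Finset.mem_filter] using hO hc
    exact ⟨hS.1 h1, h2, fun h => h2 (hS.1 h), h3, h4⟩

theorem right_below_notMem (hS : IsStrip q a lam nu) (hO : O ⊆ corners q a lam nu) {i j : ℕ}
    (hc : (i, j) ∈ (diagram lam \ diagram nu) ∪ O) :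
    (i, j + 1) ∉ diagram nu ∧ (i + 1, j) ∉ diagram nu := by
  obtain ⟨-, -, h1, h2, -⟩ := nbr_notMem hS hO hc
  unfold nbr at h1
  unfold nbr' at h2
  split_ifs at h1 h2
  · exact ⟨h1, h2⟩
  · exact ⟨h2, h1⟩

theorem isTableau_adjoin (hS : IsStrip q a lam nu) (hO : O ⊆ corners q a lam nu)
    (hT : IsTableau q a (diagram nu) T) :
    IsTableau q (a + 1) (diagram lam) (adjoin a ((diagram lam \ diagram nu) ∪ O) T) := by
  have hlt := hT.lt
  refine ⟨fun c hc => ?_, fun c hc => ?_, ?_, ?_, ?_, ?_, ?_, ?_⟩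
  · by_cases hn : c ∈ diagram nu
    · obtain ⟨e, he⟩ := hT.nonempty c hn
      exact ⟨e, mem_adjoin.2 (Or.inl he)⟩
    · exact ⟨a, mem_adjoin.2 (Or.inr ⟨rfl, Finset.mem_union_left _ (Finset.mem_sdiff.2 ⟨hc, hn⟩)⟩)⟩
  · refine Finset.eq_empty_of_forall_notMem fun e he => hc ?_
    rcases mem_adjoin.1 he with k | ⟨-, k⟩
    · exact hS.1 (hT.mem k)
    · exact (nbr_notMem hS hO k).1
  · intro i j j' hj e he e' he'
    rcases mem_adjoin.1 he with k | ⟨rfl, k⟩ <;> rcases mem_adjoin.1 he' with k' | ⟨rfl, k'⟩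
    · exact hT.row_weak i j j' hj e k e' k'
    · exact (hlt _ _ k).le
    · exact absurd (mem_diagram_of_le (hT.mem k') (by
        have := (mem_diagram.1 (nbr_notMem hS hO k).1).1; omega) le_rfl hj)
        (right_below_notMem hS hO k).1
    · exact le_rfl
  · intro i i' j hi e he e' he'
    rcases mem_adjoin.1 he with k | ⟨rfl, k⟩ <;> rcases mem_adjoin.1 he' with k' | ⟨rfl, k'⟩
    · exact hT.col_weak i i' j hi e k e' k'
    · exact (hlt _ _ k).le
    · exact absurd (mem_diagram_of_le (hT.mem k') (by
        have := (mem_diagram.1 (hT.mem k')).1; omega) hi le_rfl)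
        (right_below_notMem hS hO k).2
    · exact le_rfl
  · intro e ho i i' j he he'
    rcases mem_adjoin.1 he with k | ⟨rfl, k⟩ <;> rcases mem_adjoin.1 he' with k' | ⟨h, k'⟩
    · exact hT.col_unprimed e ho i i' j k k'
    · have := hlt _ _ k; omega
    · have := hlt _ _ k'; omega
    · have key : ∀ i i', (i, j) ∈ diagram lam \ diagram nu ∪ O →
          (i', j) ∈ diagram lam \ diagram nu ∪ O → ¬ i < i' := fun i i' h h' hi => by
        obtain ⟨h1, h2, -⟩ := nbr_notMem hS hO h
        have h3 := (nbr_notMem hS hO h').1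
        rw [nbr, if_neg (Nat.not_even_iff_odd.2 ho)] at h2
        exact h2 (mem_diagram_of_le h3 (by have := (mem_diagram.1 h3).1; dsimp only; omega) hi le_rfl)
      exact le_antisymm (not_lt.1 (key _ _ k' k)) (not_lt.1 (key _ _ k k'))
  · intro e ho i j j' he he'
    rcases mem_adjoin.1 he with k | ⟨rfl, k⟩ <;> rcases mem_adjoin.1 he' with k' | ⟨h, k'⟩
    · exact hT.row_primed e ho i j j' k k'
    · have := hlt _ _ k; omega
    · have := hlt _ _ k'; omega
    · have key : ∀ j j', (i, j) ∈ diagram lam \ diagram nu ∪ O →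
          (i, j') ∈ diagram lam \ diagram nu ∪ O → ¬ j < j' := fun j j' h h' hj => by
        obtain ⟨h1, h2, -⟩ := nbr_notMem hS hO h
        have h3 := (nbr_notMem hS hO h').1
        rw [nbr, if_pos ho] at h2
        exact h2 (mem_diagram_of_le h3 (by have := (mem_diagram.1 h1).1; dsimp only; omega) le_rfl hj)
      exact le_antisymm (not_lt.1 (key _ _ k' k)) (not_lt.1 (key _ _ k k'))
  · intro c e he
    rcases mem_adjoin.1 he with k | ⟨rfl, k⟩
    · exact hT.allowed c e k
    · exact (nbr_notMem hS hO k).2.2.2.2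
  · intro c e he
    rcases mem_adjoin.1 he with k | ⟨rfl, k⟩
    · have := hlt _ _ k; omega
    · omega

theorem filter_adjoin (hT : IsTableau q a (diagram nu) T) (M : Finset (ℕ × ℕ)) (c : ℕ × ℕ) :
    (adjoin a M T c).filter (· < a) = T c := by
  ext e
  rw [Finset.mem_filter, mem_adjoin]
  constructor
  · rintro ⟨h | ⟨rfl, -⟩, h'⟩
    · exact h
    · omega
  · exact fun h => ⟨Or.inl h, hT.lt _ _ h⟩

/-- Removing the largest letter `a` from a tableau leaves a tableau of a shape `nu`. -/
theorem exists_adjoin (hT : IsTableau q (a + 1) (diagram lam) T) :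
    ∃ nu T' O, IsStrip q a lam nu ∧ O ⊆ corners q a lam nu ∧ IsTableau q a (diagram nu) T' ∧
      adjoin a ((diagram lam \ diagram nu) ∪ O) T' = T := by
  classical
  have hle : ∀ {c e}, e ∈ T c → e ≤ a := fun he => Nat.lt_succ_iff.1 (hT.lt _ _ he)
  obtain ⟨nu, hnu⟩ := exists_diagram_eq
      (I := (diagram lam).filter fun c => ((T c).filter (· < a)).Nonempty)
    (fun i j h => (mem_diagram.1 (Finset.mem_filter.1 h).1).1) (by
      intro i j i' j' h hij hi hj
      obtain ⟨h1, e, he⟩ := Finset.mem_filter.1 h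
      obtain ⟨he, hea⟩ := Finset.mem_filter.1 he
      have h2 := mem_diagram_of_le h1 hij hi hj
      have h3 : (i, j') ∈ diagram lam := mem_diagram_of_le h1 (hij.trans hj) hi le_rfl
      refine Finset.mem_filter.2 ⟨h2, ?_⟩
      obtain ⟨f, hf⟩ := hT.nonempty _ h3
      obtain ⟨g, hg⟩ := hT.nonempty _ h2
      have hfe : ∃ f ∈ T (i, j'), f ≤ e := by
        rcases hi.eq_or_lt with rfl | hi
        · exact ⟨e, he, le_rfl⟩
        · exact ⟨f, hf, hT.col_weak _ _ _ hi _ hf _ he⟩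
      obtain ⟨f, hf, hfe⟩ := hfe
      have hgf : ∃ g ∈ T (i, j), g ≤ f := by
        rcases hj.eq_or_lt with rfl | hj
        · exact ⟨f, hf, le_rfl⟩
        · exact ⟨g, hg, hT.row_weak _ _ _ hj _ hg _ hf⟩
      obtain ⟨g, hg, hgf⟩ := hgf
      exact ⟨g, Finset.mem_filter.2 ⟨hg, (hgf.trans hfe).trans_lt hea⟩⟩)
  have hmem : ∀ {c}, c ∈ diagram nu ↔ ∃ e ∈ T c, e < a := fun {c} => by
    rw [hnu, Finset.mem_filter]
    constructor
    · rintro ⟨-, e, he⟩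
      exact ⟨e, Finset.mem_filter.1 he⟩
    · rintro ⟨e, he, hea⟩
      exact ⟨hT.mem he, e, Finset.mem_filter.2 ⟨he, hea⟩⟩
  have hsub : diagram nu ⊆ diagram lam := hnu ▸ Finset.filter_subset _ _
  -- a box containing `a` has no neighbour on the side on which `a` cannot be repeated
  have hn : ∀ c, a ∈ T c → nbr a c ∉ diagram lam := by
    rintro ⟨i, j⟩ hc hn
    obtain ⟨e, he⟩ := hT.nonempty _ hn
    unfold nbr at he hn
    split_ifs at he hn with ha
    · obtain rfl := le_antisymm (hle he) (hT.row_weak _ _ _ (Nat.lt_succ_self j) _ hc _ he)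
      exact absurd (hT.row_primed _ ha _ _ _ hc he) (by simp)
    · obtain rfl := le_antisymm (hle he) (hT.col_weak _ _ _ (Nat.lt_succ_self i) _ hc _ he)
      exact absurd (hT.col_unprimed _ (Nat.not_even_iff_odd.1 ha) _ _ _ hc he) (by simp)
  have hn' : ∀ c, a ∈ T c → nbr' a c ∉ diagram nu := by
    rintro ⟨i, j⟩ hc hn
    obtain ⟨e, he, hea⟩ := hmem.1 hn
    unfold nbr' at he
    split_ifs at he
    · have := hT.col_weak _ _ _ (Nat.lt_succ_self i) _ hc _ he; omega
    · have := hT.row_weak _ _ _ (Nat.lt_succ_self j) _ hc _ he; omega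
  have ha : ∀ c ∈ diagram lam, c ∉ diagram nu → a ∈ T c := by
    intro c hc hcn
    obtain ⟨e, he⟩ := hT.nonempty c hc
    rcases (hle he).eq_or_lt with rfl | h
    · exact he
    · exact absurd (hmem.2 ⟨e, he, h⟩) hcn
  have hf : ∀ {c e}, e ∈ (T c).filter (· < a) → e ∈ T c := fun h => (Finset.mem_filter.1 h).1
  refine ⟨nu, fun c => (T c).filter (· < a), (diagram nu).filter fun c => a ∈ T c,
    ⟨hsub, fun c h1 h2 => ⟨hn c (ha c h1 h2), hT.allowed c a (ha c h1 h2)⟩⟩, ?_, ?_, ?_⟩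
  · intro c hc
    obtain ⟨h1, h2⟩ := Finset.mem_filter.1 hc
    simp only [corners, Finset.mem_filter]
    exact ⟨h1, hn c h2, hn' c h2, hT.allowed c a h2⟩
  · refine ⟨fun c hc => ?_, fun c hc => ?_, fun i j j' h e he e' he' => ?_,
      fun i i' j h e he e' he' => ?_, fun e ho i i' j he he' => ?_,
      fun e ho i j j' he he' => ?_, fun c e he => ?_, fun c e he => (Finset.mem_filter.1 he).2⟩
    · obtain ⟨e, he, hea⟩ := hmem.1 hc
      exact ⟨e, Finset.mem_filter.2 ⟨he, hea⟩⟩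
    · exact Finset.eq_empty_of_forall_notMem fun e he => hc (hmem.2 ⟨e, Finset.mem_filter.1 he⟩)
    · exact hT.row_weak i j j' h e (hf he) e' (hf he')
    · exact hT.col_weak i i' j h e (hf he) e' (hf he')
    · exact hT.col_unprimed e ho i i' j (hf he) (hf he')
    · exact hT.row_primed e ho i j j' (hf he) (hf he')
    · exact hT.allowed c e (hf he)
  · funext c
    ext e
    rw [mem_adjoin, Finset.mem_union, Finset.mem_sdiff, Finset.mem_filter, Finset.mem_filter]
    constructor
    · rintro (⟨h, -⟩ | ⟨rfl, ⟨h1, h2⟩ | ⟨-, h⟩⟩)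
      · exact h
      · exact ha c h1 h2
      · exact h
    · intro he
      rcases (hle he).eq_or_lt with rfl | h
      · refine Or.inr ⟨rfl, ?_⟩
        by_cases hc : c ∈ diagram nu
        · exact Or.inr ⟨hc, he⟩
        · exact Or.inl ⟨hT.mem he, hc⟩
      · exact Or.inl ⟨he, h⟩

end Adjoin

/-! ### Generating functions in finitely many variables -/

section GenFun

variable {R : Type*} [CommRing R]

/-- The contribution of a box with content `S`. Since `S` is nonempty in a tableau, the exponent is a
true difference. -/
def boxWeight (x : ℕ → R) (b : R) (S : Finset ℕ) : R := b ^ (S.card - 1) * ∏ e ∈ S, x (e / 2)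

/-- The contribution `b ^ (|T| - |D|) x ^ T` of a tableau `T` of shape `D`. -/
def tableauWeight (x : ℕ → R) (b : R) (D : Finset (ℕ × ℕ)) (T : ℕ × ℕ → Finset ℕ) : R :=
  ∏ c ∈ D, boxWeight x b (T c)

/-- The generating function of the tableaux with letters `< a` whose shape is encoded by `n`. -/
noncomputable def genFun (x : ℕ → R) (b : R) (q : Bool) (a n : ℕ) : R :=
  ∑ T ∈ tableaux q a n, tableauWeight x b (diagram n) T

theorem tableauWeight_adjoin (x : ℕ → R) (b : R) {q : Bool} {a lam nu : ℕ}
    {T : ℕ × ℕ → Finset ℕ} {O : Finset (ℕ × ℕ)} (hsub : diagram nu ⊆ diagram lam)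
    (hO : O ⊆ diagram nu) (hT : IsTableau q a (diagram nu) T) :
    tableauWeight x b (diagram lam) (adjoin a ((diagram lam \ diagram nu) ∪ O) T) =
      tableauWeight x b (diagram nu) T *
        (x (a / 2) ^ (diagram lam \ diagram nu).card * (b * x (a / 2)) ^ O.card) := by
  unfold tableauWeight
  rw [← Finset.prod_sdiff hsub]
  have h1 : ∏ c ∈ diagram lam \ diagram nu,
      boxWeight x b (adjoin a ((diagram lam \ diagram nu) ∪ O) T c) =
        x (a / 2) ^ (diagram lam \ diagram nu).card := by
    rw [Finset.prod_congr rfl fun c hc => ?_, Finset.prod_const]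
    rw [adjoin, if_pos (Finset.mem_union_left _ hc), hT.eq_empty c (Finset.mem_sdiff.1 hc).2]
    simp [boxWeight]
  have h2 : ∏ c ∈ diagram nu,
      boxWeight x b (adjoin a ((diagram lam \ diagram nu) ∪ O) T c) =
        (∏ c ∈ diagram nu, boxWeight x b (T c)) * (b * x (a / 2)) ^ O.card := by
    have h3 : (b * x (a / 2)) ^ O.card =
        ∏ c ∈ diagram nu, if c ∈ O then b * x (a / 2) else 1 := by
      rw [Finset.prod_ite_mem, Finset.inter_eq_right.2 hO, Finset.prod_const]
    rw [h3, ← Finset.prod_mul_distrib]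
    refine Finset.prod_congr rfl fun c hc => ?_
    have h4 : c ∈ diagram lam \ diagram nu ∪ O ↔ c ∈ O := by simp [hc]
    by_cases hcO : c ∈ O
    · have ha : a ∉ T c := fun h => lt_irrefl _ (hT.lt _ _ h)
      obtain ⟨k, hk⟩ := Nat.exists_eq_succ_of_ne_zero (hT.nonempty c hc).card_ne_zero
      rw [adjoin, if_pos (h4.2 hcO), if_pos hcO, boxWeight, boxWeight,
        Finset.union_comm, ← Finset.insert_eq, Finset.card_insert_of_notMem ha,
        Finset.prod_insert ha, hk, Nat.succ_eq_add_one, Nat.add_sub_cancel, Nat.add_sub_cancel]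
      ring
    · rw [adjoin, if_neg (mt h4.1 hcO), if_neg hcO, Finset.union_empty, mul_one]
  rw [h1, h2]
  ring

theorem adjoin_injective {q : Bool} {a lam nu nu' : ℕ} {T T' : ℕ × ℕ → Finset ℕ}
    {O O' : Finset (ℕ × ℕ)} (hO : O ⊆ diagram nu) (hO' : O' ⊆ diagram nu')
    (hT : IsTableau q a (diagram nu) T) (hT' : IsTableau q a (diagram nu') T')
    (h : adjoin a ((diagram lam \ diagram nu) ∪ O) T =
      adjoin a ((diagram lam \ diagram nu') ∪ O') T') : nu = nu' ∧ T = T' ∧ O = O' := by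
  have hTT : T = T' := funext fun c => by
    rw [← filter_adjoin hT ((diagram lam \ diagram nu) ∪ O), h, filter_adjoin hT']
  subst hTT
  have hnu : diagram nu = diagram nu' := by
    ext c
    exact ⟨fun hc => hT'.mem (hT.nonempty c hc).choose_spec,
      fun hc => hT.mem (hT'.nonempty c hc).choose_spec⟩
  refine ⟨diagram_injective hnu, rfl, ?_⟩
  have ha : ∀ c, a ∉ T c := fun c h => lt_irrefl _ (hT.lt _ _ h)
  ext c
  have hc := congrArg (a ∈ ·) (congrFun h c)
  simp only [mem_adjoin, ha, false_or, true_and, Finset.mem_union, Finset.mem_sdiff, hnu] at hc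
  rw [hnu] at hO
  constructor
  · intro h1
    have h2 := hO h1
    have := hc.mp (Or.inr h1)
    tauto
  · intro h1
    have h2 := hO' h1
    have := hc.mpr (Or.inr h1)
    tauto

/-- Adding the letter `a` acts on generating functions by the operator `letterStep`: a tableau is a
smaller tableau together with a set of corners, and the sum over the latter is a power of
`1 + b x`. -/
theorem genFun_succ (x : ℕ → R) (b : R) (q : Bool) (a lam : ℕ) :
    genFun x b q (a + 1) lam =
      letterStep (x (a / 2)) (1 + b * x (a / 2)) q a (genFun x b q a) lam := by
  classical
  have hlt : lam < 2 ^ lam := Nat.lt_two_pow_self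
  have hterm : ∀ nu ∈ (Finset.range (2 ^ lam)).filter (IsStrip q a lam),
      genFun x b q a nu * (x (a / 2) ^ (diagram lam \ diagram nu).card *
        (1 + b * x (a / 2)) ^ (corners q a lam nu).card) =
      ∑ p ∈ tableaux q a nu ×ˢ (corners q a lam nu).powerset,
        tableauWeight x b (diagram nu) p.1 *
        (x (a / 2) ^ (diagram lam \ diagram nu).card * (b * x (a / 2)) ^ p.2.card) := by
    intro nu _
    rw [Finset.sum_product, genFun, Finset.sum_mul]
    refine Finset.sum_congr rfl fun T _ => ?_
    dsimp only
    rw [← Finset.mul_sum, ← Finset.mul_sum]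
    congr 2
    simpa [add_comm] using (Finset.sum_pow_mul_eq_add_pow (b * x (a / 2)) 1 _).symm
  rw [letterStep_eq_sum _ _ q a _ hlt,
    Finset.sum_congr rfl fun nu hnu => by
      rw [letterStep_pointMass _ _ q a hlt (Finset.mem_range.1 hnu), mul_ite, mul_zero],
    ← Finset.sum_filter, Finset.sum_congr rfl hterm, Finset.sum_sigma', genFun]
  symm
  refine Finset.sum_bij
    (fun p _ => adjoin a ((diagram lam \ diagram p.1) ∪ p.2.2) p.2.1) ?_ ?_ ?_ ?_
  · rintro ⟨nu, T, O⟩ hp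
    simp only [Finset.mem_sigma, Finset.mem_filter, Finset.mem_product, Finset.mem_powerset,
      mem_tableaux] at hp
    exact mem_tableaux.2 (isTableau_adjoin hp.1.2 hp.2.2 hp.2.1)
  · rintro ⟨nu, T, O⟩ hp ⟨nu', T', O'⟩ hp' h
    simp only [Finset.mem_sigma, Finset.mem_filter, Finset.mem_product, Finset.mem_powerset,
      mem_tableaux] at hp hp'
    obtain ⟨rfl, rfl, rfl⟩ := adjoin_injective (hp.2.2.trans (Finset.filter_subset _ _))
      (hp'.2.2.trans (Finset.filter_subset _ _)) hp.2.1 hp'.2.1 h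
    rfl
  · intro T hT
    obtain ⟨nu, T', O, h1, h2, h3, h4⟩ := exists_adjoin (mem_tableaux.1 hT)
    refine ⟨⟨nu, T', O⟩, ?_, h4⟩
    simp only [Finset.mem_sigma, Finset.mem_filter, Finset.mem_product, Finset.mem_powerset,
      mem_tableaux, Finset.mem_range]
    refine ⟨⟨lt_two_pow_of_height_eq_zero (Nat.le_zero.1 ?_), h1⟩, h3, h2⟩
    exact (diagram_subset_iff.1 h1.1 lam).trans (height_eq_zero hlt le_rfl).le
  · rintro ⟨nu, T, O⟩ hp
    simp only [Finset.mem_sigma, Finset.mem_filter, Finset.mem_product, Finset.mem_powerset,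
      mem_tableaux] at hp
    exact (tableauWeight_adjoin x b hp.1.2.1 (hp.2.2.trans (Finset.filter_subset _ _)) hp.2.1).symm

theorem diagram_zero : diagram 0 = ∅ := rfl

theorem genFun_zero (x : ℕ → R) (b : R) (q : Bool) (n : ℕ) :
    genFun x b q 0 n = if n = 0 then 1 else 0 := by
  have hempty : ∀ T, IsTableau q 0 (diagram n) T → diagram n = ∅ := fun T hT =>
    Finset.eq_empty_of_forall_notMem fun c hc => by
      obtain ⟨e, he⟩ := hT.nonempty c hc
      exact Nat.not_lt_zero _ (hT.lt _ _ he)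
  split_ifs with hn
  · subst hn
    have : tableaux q 0 0 = {fun _ => ∅} := by
      ext T
      rw [mem_tableaux, Finset.mem_singleton, diagram_zero]
      constructor
      · exact fun hT => funext fun c => hT.eq_empty c (Finset.notMem_empty c)
      · rintro rfl
        constructor <;> simp
    rw [genFun, this, Finset.sum_singleton, tableauWeight, diagram_zero, Finset.prod_empty]
  · refine Finset.sum_eq_zero fun T hT => absurd (hempty T (mem_tableaux.1 hT)) ?_
    rw [← diagram_zero]
    exact fun h => hn (diagram_injective h)

theorem genFun_true_succ_succ (x : ℕ → R) (b : R) (k n : ℕ) :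
    genFun x b true (2 * (k + 1)) n =
      addQ (x k) (1 + b * x k) (genFun x b true (2 * k)) n := by
  rw [show 2 * (k + 1) = 2 * k + 1 + 1 by ring, genFun_succ,
    show genFun x b true (2 * k + 1) = _ from funext fun m => genFun_succ x b true (2 * k) m]
  have h1 : (2 * k + 1) / 2 = k := by omega
  have h2 : 2 * k / 2 = k := by omega
  have h3 : letterStep (x k) (1 + b * x k) true (2 * k) (genFun x b true (2 * k)) = fun m =>
      vStrip (x k) (1 + b * x k) .free (genFun x b true (2 * k)) m +
        x k * vStrip (x k) (1 + b * x k) .moving (genFun x b true (2 * k)) m := by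
    funext m
    simp [letterStep]
  rw [h1, h2, h3]
  simp [letterStep, addQ]

theorem genFun_false_succ_succ (x : ℕ → R) (b : R) (k n : ℕ) :
    genFun x b false (2 * (k + 1)) n =
      addP (x k) (1 + b * x k) (genFun x b false (2 * k)) n := by
  rw [show 2 * (k + 1) = 2 * k + 1 + 1 by ring, genFun_succ,
    show genFun x b false (2 * k + 1) = _ from funext fun m => genFun_succ x b false (2 * k) m]
  have h1 : (2 * k + 1) / 2 = k := by omega
  have h2 : 2 * k / 2 = k := by omega
  have h3 : letterStep (x k) (1 + b * x k) false (2 * k) (genFun x b false (2 * k)) =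
      vStrip (x k) (1 + b * x k) .blocked (genFun x b false (2 * k)) := by
    funext m
    simp [letterStep]
  rw [h1, h2, h3]
  simp [letterStep, addP]

theorem hop_pointMass_bit (b : R) (s c d : Bool) (m n : ℕ) :
    hop b s (pointMass (Nat.bit d n)) (Nat.bit c m) =
      hopWeight b s c d * hop b (hopNext s c d) (pointMass n) m := by
  rw [hop_bit, pointMass_bit, pointMass_bit, hop_mul, hop_mul]
  cases d <;> simp

theorem hop_pointMass_zero (b : R) (n : ℕ) :
    hop b false (pointMass 0) n = pointMass 0 n ∧ hop b true (pointMass 0) n = 0 := by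
  induction n using Nat.binaryRec' with
  | zero => simp [hop_zero, hopBoundary, pointMass]
  | bit c n h ih =>
    rw [show (0 : ℕ) = Nat.bit false 0 from rfl, hop_pointMass_bit, hop_pointMass_bit]
    cases c
    · simp [hopWeight, hopNext, ih.1, pointMass]
    · simp [hopWeight, hopNext, ih.2, pointMass]

/-- In finitely many variables, the `Q`-generating functions are the images of the `P`-generating
functions under `hop`. -/
theorem genFun_eq_hop (x : ℕ → R) (b : R) (k : ℕ) :
    genFun x b true (2 * k) = hop b false (genFun x b false (2 * k)) := by
  induction k with
  | zero =>
    funext n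
    rw [Nat.mul_zero, genFun_zero, show genFun x b false 0 = pointMass 0 from
      funext fun m => genFun_zero ..]
    exact (hop_pointMass_zero b n).1.symm
  | succ k ih =>
    funext n
    rw [genFun_true_succ_succ, ih, addQ_hop _ _ rfl,
      show genFun x b false (2 * (k + 1)) = _ from funext fun m => genFun_false_succ_succ ..]

end GenFun

/-! ### Binary encoding of strict partitions -/

namespace StrictPartition

theorem getD_add_le (lam : StrictPartition) {i i' : ℕ} (h : i ≤ i') (hi : 0 < lam.parts.getD i' 0) :
    lam.parts.getD i' 0 + (i' - i) ≤ lam.parts.getD i 0 := by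
  have hlen : i' < lam.parts.length := by
    by_contra hc
    rw [List.getD_eq_default _ _ (not_lt.1 hc)] at hi
    omega
  induction i', h using Nat.le_induction with
  | base => simp
  | succ k hk ih =>
    have h1 := List.pairwise_iff_getElem.1 lam.strictAnti k (k + 1) (by omega) hlen (by omega)
    rw [List.getD_eq_getElem _ _ hlen] at hi ⊢
    have h2 := ih (by rw [List.getD_eq_getElem _ _ (by omega)]; omega) (by omega)
    rw [List.getD_eq_getElem _ _ (by omega)] at h2
    omega

theorem exists_code (lam : StrictPartition) : ∃ n, diagram n = lam.shiftedDiagram := by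
  refine exists_diagram_eq (fun i j h => ((mem_shiftedDiagram ..).1 h).1) ?_
  intro i j i' j' h hij hi hj
  rw [mem_shiftedDiagram] at *
  have := lam.getD_add_le hi (by omega)
  exact ⟨hij, by omega⟩

/-- The number with binary digit `p` equal to `1` iff `p + 1` is a part (`testBit_code`). -/
noncomputable def code (lam : StrictPartition) : ℕ := lam.exists_code.choose

theorem diagram_code (lam : StrictPartition) : diagram lam.code = lam.shiftedDiagram :=
  lam.exists_code.choose_spec

theorem lt_height_code (lam : StrictPartition) (i p : ℕ) :
    i < height lam.code p ↔ p < lam.parts.getD i 0 := by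
  rw [← mem_diagram_add, diagram_code, mem_shiftedDiagram]
  omega

theorem getD_injective {lam mu : StrictPartition}
    (h : ∀ i, lam.parts.getD i 0 = mu.parts.getD i 0) : lam = mu := by
  have hlen : ∀ (nu : StrictPartition) i, i < nu.parts.length ↔ 0 < nu.parts.getD i 0 := by
    intro nu i
    constructor
    · intro hi
      rw [List.getD_eq_getElem _ _ hi]
      exact nu.pos _ (List.getElem_mem hi)
    · intro hi
      by_contra hc
      rw [List.getD_eq_default _ _ (not_lt.1 hc)] at hi
      omega
  have hl : lam.parts.length = mu.parts.length := by
    refine eq_of_forall_lt_iff fun i => ?_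
    rw [hlen, hlen, h]
  have hp : lam.parts = mu.parts := by
    refine List.ext_getElem hl fun i h1 h2 => ?_
    rw [← List.getD_eq_getElem _ 0 h1, ← List.getD_eq_getElem _ 0 h2, h]
  cases lam
  cases mu
  simpa using hp

theorem code_injective : Function.Injective code := by
  intro lam mu h
  refine getD_injective fun i => eq_of_forall_lt_iff fun p => ?_
  rw [← lt_height_code, ← lt_height_code, h]

theorem code_surjective : Function.Surjective code := by
  intro n
  obtain ⟨lam, h⟩ : ∃ lam : StrictPartition,
      ∀ i p, i < height n p ↔ p < lam.parts.getD i 0 := by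
    induction n using Nat.binaryRec' with
    | zero => exact ⟨⟨[], List.Pairwise.nil, by simp⟩, by simp [height_zero]⟩
    | bit b n _ ih =>
      obtain ⟨lam, h⟩ := ih
      have hlen : height n 0 = lam.parts.length := by
        refine eq_of_forall_lt_iff fun i => ?_
        rw [h]
        constructor
        · intro hi
          by_contra hc
          rw [List.getD_eq_default _ _ (not_lt.1 hc)] at hi
          omega
        · intro hi
          rw [List.getD_eq_getElem _ _ hi]
          exact lam.pos _ (List.getElem_mem hi)
      refine ⟨⟨lam.parts.map (· + 1) ++ (if b then [1] else []), ?_, ?_⟩, ?_⟩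
      · rw [List.pairwise_append]
        refine ⟨?_, by cases b <;> simp, ?_⟩
        · rw [List.pairwise_map]
          exact lam.strictAnti.imp fun h => by omega
        · intro a ha c hc
          obtain ⟨a', ha', rfl⟩ := List.mem_map.1 ha
          have := lam.pos a' ha'
          cases b <;> simp at hc
          omega
      · intro a ha
        rcases List.mem_append.1 ha with ha | ha
        · obtain ⟨a', ha', rfl⟩ := List.mem_map.1 ha
          omega
        · cases b <;> simp at ha
          omega
      · intro i p
        dsimp only
        by_cases hi : i < lam.parts.length
        · rw [List.getD_append _ _ _ _ (by simpa using hi),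
            List.getD_eq_getElem _ _ (by simpa using hi), List.getElem_map]
          cases p with
          | zero => rw [height_bit_zero]; omega
          | succ p => rw [height_bit_succ, h, List.getD_eq_getElem _ _ hi]; omega
        · rw [List.getD_append_right _ _ _ _ (by simpa using hi), List.length_map]
          cases p with
          | zero =>
            rw [height_bit_zero, hlen]
            cases b
            · simp; omega
            · rcases (not_lt.1 hi).eq_or_lt with h1 | h1
              · simp [← h1]
              · rw [List.getD_eq_default _ _ (by simp; omega)]
                simp; omega
          | succ p =>
            rw [height_bit_succ, h, List.getD_eq_default _ _ (not_lt.1 hi)]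
            cases b
            · simp
            · rcases (not_lt.1 hi).eq_or_lt with h1 | h1
              · simp [← h1]
              · rw [List.getD_eq_default _ _ (by simp; omega)]
                simp
  refine ⟨lam, diagram_injective ?_⟩
  ext ⟨i, j⟩
  rw [diagram_code, mem_shiftedDiagram, mem_diagram, h]
  omega

theorem testBit_code (lam : StrictPartition) (p : ℕ) :
    lam.code.testBit p = true ↔ p + 1 ∈ lam.parts := by
  have h1 := height_eq_testBit_add lam.code p
  have h2 : lam.code.testBit p = true ↔ ∃ i, i < height lam.code p ∧ ¬ i < height lam.code (p + 1) := by
    constructor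
    · intro h
      refine ⟨height lam.code (p + 1), ?_, lt_irrefl _⟩
      rw [h1, h]
      simp
    · rintro ⟨i, h3, h4⟩
      cases h : lam.code.testBit p
      · rw [h] at h1; simp at h1; omega
      · rfl
  rw [h2, List.mem_iff_getElem]
  simp only [lt_height_code]
  constructor
  · rintro ⟨i, h3, h4⟩
    have hi : i < lam.parts.length := by
      by_contra hc
      rw [List.getD_eq_default _ _ (not_lt.1 hc)] at h3
      omega
    rw [List.getD_eq_getElem _ _ hi] at h3 h4
    exact ⟨i, hi, by omega⟩
  · rintro ⟨i, hi, h3⟩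
    refine ⟨i, ?_⟩
    rw [List.getD_eq_getElem _ _ hi]
    omega

/-- The strict partition encoded by `n`. -/
noncomputable def ofCode (n : ℕ) : StrictPartition := Function.surjInv code_surjective n

@[simp] theorem code_ofCode (n : ℕ) : (ofCode n).code = n := Function.surjInv_eq code_surjective n

@[simp] theorem ofCode_code (lam : StrictPartition) : ofCode lam.code = lam :=
  code_injective (code_ofCode _)

/-! ### Coefficients of `GP` and `GQ` -/

theorem tableauWeight_eq_monomial (lam : StrictPartition) {T : ℕ × ℕ → Finset ℕ}
    (hT : ∀ c ∈ lam.shiftedDiagram, (T c).Nonempty) :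
    tableauWeight (R := MvPowerSeries ℕ ℤ[X]) MvPowerSeries.X (MvPowerSeries.C Polynomial.X)
      lam.shiftedDiagram T = MvPowerSeries.monomial (lam.weight T)
        (Polynomial.X ^ (lam.numEntries T - lam.shiftedDiagram.card)) := by
  have hbox : ∀ S : Finset ℕ, boxWeight (R := MvPowerSeries ℕ ℤ[X]) MvPowerSeries.X
      (MvPowerSeries.C Polynomial.X) S =
        MvPowerSeries.monomial (∑ a ∈ S, Finsupp.single (a / 2) 1)
          (Polynomial.X ^ (S.card - 1)) := by
    intro S
    simp only [boxWeight, MvPowerSeries.X]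
    rw [MvPowerSeries.prod_monomial, Finset.prod_const_one, ← map_pow,
      ← MvPowerSeries.monomial_zero_eq_C_apply,
      MvPowerSeries.monomial_mul_monomial, zero_add, mul_one]
  simp only [tableauWeight, hbox]
  rw [MvPowerSeries.prod_monomial, Finset.prod_pow_eq_pow_sum, weight, numEntries,
    Finset.card_eq_sum_ones lam.shiftedDiagram,
    ← Finset.sum_tsub_distrib _ fun c hc => Finset.card_pos.2 (hT c hc)]

theorem isTableau_iff (lam : StrictPartition) {T : ℕ × ℕ → Finset ℕ} {d : ℕ →₀ ℕ} {k : ℕ}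
    (hd : ∀ i, k ≤ i → d i = 0) (hw : lam.weight T = d) :
    (IsTableau true (2 * k) (diagram lam.code) T ↔ lam.IsSetShYTQ T) ∧
      (IsTableau false (2 * k) (diagram lam.code) T ↔ lam.IsSetShYTP T) := by
  have hlt : ∀ c ∈ lam.shiftedDiagram, ∀ e ∈ T c, e < 2 * k := by
    intro c hc e he
    by_contra hk
    have h1 : (1 : ℕ) ≤ d (e / 2) := by
      rw [← hw, weight, Finsupp.finsetSum_apply]
      refine le_trans ?_ (Finset.single_le_sum (fun _ _ => Nat.zero_le _) hc)
      rw [Finsupp.finsetSum_apply]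
      refine le_trans ?_ (Finset.single_le_sum (fun _ _ => Nat.zero_le _) he)
      simp
    rw [hd _ (by omega)] at h1
    omega
  have hlt' : lam.IsSetShYTQ T → ∀ c, ∀ e ∈ T c, e < 2 * k := by
    intro hT c e he
    by_cases hc : c ∈ lam.shiftedDiagram
    · exact hlt c hc e he
    · rw [hT.eq_empty c hc] at he
      exact absurd he (Finset.notMem_empty _)
  rw [diagram_code]
  refine ⟨⟨fun h => ⟨h.1, h.2, h.3, h.4, h.5, h.6⟩, fun h =>
    ⟨h.1, h.2, h.3, h.4, h.5, h.6, fun _ _ _ hq => absurd hq (by simp), hlt' h⟩⟩,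
    ⟨fun h => ⟨⟨h.1, h.2, h.3, h.4, h.5, h.6⟩, fun i e he hev => h.7 _ e he rfl hev rfl⟩, fun h =>
    ⟨h.1.1, h.1.2, h.1.3, h.1.4, h.1.5, h.1.6, ?_, hlt' h.1⟩⟩⟩
  rintro ⟨i, j⟩ e he - hev (rfl : i = j)
  exact h.2 i e he hev

/-- A coefficient of `GP` or `GQ` is found in any sufficiently large number of variables. -/
theorem coeff_genFun (lam : StrictPartition) (q : Bool) {d : ℕ →₀ ℕ} {k : ℕ}
    (hd : ∀ i, k ≤ i → d i = 0) :
    MvPowerSeries.coeff d (genFun (R := MvPowerSeries ℕ ℤ[X]) MvPowerSeries.X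
      (MvPowerSeries.C Polynomial.X) q (2 * k) lam.code) =
        MvPowerSeries.coeff d (if q then lam.GQ else lam.GP) := by
  classical
  have hsum : MvPowerSeries.coeff d (genFun (R := MvPowerSeries ℕ ℤ[X]) MvPowerSeries.X
      (MvPowerSeries.C Polynomial.X) q (2 * k) lam.code) = ∑ T ∈ (tableaux q (2 * k) lam.code).filter fun T => lam.weight T = d,
        Polynomial.X ^ (lam.numEntries T - lam.shiftedDiagram.card) := by
    rw [genFun, map_sum, Finset.sum_filter]
    refine Finset.sum_congr rfl fun T hT => ?_
    rw [mem_tableaux, diagram_code] at hT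
    rw [diagram_code, tableauWeight_eq_monomial lam hT.nonempty, MvPowerSeries.coeff_monomial]
    simp only [eq_comm]
  rw [hsum]
  cases q
  · rw [if_neg (by simp)]
    refine Finset.sum_congr ?_ fun _ _ => rfl
    ext T
    rw [Finset.mem_filter, mem_tableaux, Set.Finite.mem_toFinset]
    exact and_congr_left fun h => (lam.isTableau_iff hd h).2
  · rw [if_pos rfl]
    refine Finset.sum_congr ?_ fun _ _ => rfl
    ext T
    rw [Finset.mem_filter, mem_tableaux, Set.Finite.mem_toFinset]
    exact and_congr_left fun h => (lam.isTableau_iff hd h).1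

end StrictPartition

namespace StrictPartition

/-! ### Linear independence of `GP` -/

/-- The weight of the tableau whose row `i` contains only the unprimed letter with variable `i`. -/
noncomputable def rowWeight (lam : StrictPartition) : ℕ →₀ ℕ :=
  ∑ c ∈ lam.shiftedDiagram, Finsupp.single c.1 1

theorem rowWeight_injective : Function.Injective rowWeight := by
  have key : ∀ (lam : StrictPartition) (i : ℕ), lam.rowWeight i = lam.parts.getD i 0 := by
    intro lam i
    have h1 : lam.shiftedDiagram.filter (fun c => c.1 = i) =
        (Finset.Ico i (i + lam.parts.getD i 0)).image fun j => (i, j) := by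
      ext ⟨i', j⟩
      simp only [Finset.mem_filter, mem_shiftedDiagram, Finset.mem_image, Finset.mem_Ico,
        Prod.mk.injEq]
      constructor
      · rintro ⟨h, rfl⟩
        exact ⟨j, h, rfl, rfl⟩
      · rintro ⟨j', h, rfl, rfl⟩
        exact ⟨h, rfl⟩
    rw [rowWeight, Finsupp.finsetSum_apply]
    simp only [Finsupp.single_apply]
    rw [← Finset.card_filter, h1,
      Finset.card_image_of_injective _ fun a b h => (Prod.mk.inj h).2, Nat.card_Ico]
    omega
  exact fun lam mu h => getD_injective fun i => by rw [← key, ← key, h]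

/-- In a `P`-tableau the entries of row `i` belong to variables `≥ i`: along the diagonal the
unprimed entries increase strictly. -/
theorem IsSetShYTP.row_le {lam : StrictPartition} {T : ℕ × ℕ → Finset ℕ}
    (hT : lam.IsSetShYTP T) {c : ℕ × ℕ} {a : ℕ} (ha : a ∈ T c) : c.1 ≤ a / 2 := by
  have hmem : ∀ {c a}, a ∈ T c → c ∈ diagram lam.code := fun {c a} h => by
    rw [diagram_code]
    by_contra hc
    rw [hT.eq_empty c hc] at h
    exact Finset.notMem_empty _ h
  have hne : ∀ {c}, c ∈ diagram lam.code → (T c).Nonempty := fun {c} h =>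
    hT.nonempty c (diagram_code lam ▸ h)
  have hdiag : ∀ i, ∀ a ∈ T (i, i), 2 * i + 1 ≤ a := by
    intro i
    induction i with
    | zero =>
      intro a ha
      have := Nat.not_even_iff.1 (hT.diag_unprimed 0 a ha)
      omega
    | succ i ih =>
      intro a ha
      obtain ⟨b, hb⟩ := hne (mem_diagram_of_le (hmem ha) le_rfl (Nat.le_succ i) (Nat.le_succ i))
      obtain ⟨e, he⟩ := hne (mem_diagram_of_le (hmem ha) (Nat.le_succ i) (Nat.le_succ i) le_rfl)
      have h1 := ih b hb
      have h2 := hT.row_weak i i (i + 1) (Nat.lt_succ_self i) b hb e he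
      have h3 := hT.col_weak i (i + 1) (i + 1) (Nat.lt_succ_self i) e he a ha
      have h4 := hT.diag_unprimed (i + 1) a ha
      have h5 : e ≠ a := by
        rintro rfl
        exact absurd (hT.col_unprimed e (Nat.not_even_iff_odd.1 h4) _ _ _ he ha) (by omega)
      have := Nat.not_even_iff.1 h4
      omega
  obtain ⟨i, j⟩ := c
  have hij := (mem_diagram.1 (hmem ha)).1
  rcases hij.eq_or_lt with rfl | hlt
  · have := hdiag i a ha
    dsimp only
    omega
  · obtain ⟨b, hb⟩ := hne (mem_diagram_of_le (hmem ha) le_rfl le_rfl hij)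
    have h1 := hdiag i b hb
    have h2 := hT.row_weak i i j hlt b hb a ha
    dsimp only
    omega

/-- The sum of the row numbers of all boxes. -/
def rowSum (lam : StrictPartition) : ℕ := ∑ c ∈ lam.shiftedDiagram, c.1

theorem degree_weight (lam : StrictPartition) (T : ℕ × ℕ → Finset ℕ) :
    (lam.weight T).degree = lam.numEntries T := by
  simp [weight, numEntries, map_sum, Finsupp.degree_single]

theorem degree_rowWeight (lam : StrictPartition) :
    lam.rowWeight.degree = lam.shiftedDiagram.card := by
  simp [rowWeight, map_sum, Finsupp.degree_single]

theorem numEntries_eq {lam mu : StrictPartition} {T : ℕ × ℕ → Finset ℕ}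
    (hw : mu.weight T = lam.rowWeight) : mu.numEntries T = lam.shiftedDiagram.card := by
  rw [← degree_weight, hw, degree_rowWeight]

/-- The monomial `rowWeight lam` occurs in `GP mu` with `mu ≠ lam` only if `mu` is smaller than `lam`
in size or, the sizes being equal, in the sum of the row numbers. -/
theorem eq_of_weight_eq_rowWeight {lam mu : StrictPartition} {T : ℕ × ℕ → Finset ℕ}
    (hT : mu.IsSetShYTP T) (hw : mu.weight T = lam.rowWeight)
    (hle : toLex (lam.shiftedDiagram.card, lam.rowSum) ≤
      toLex (mu.shiftedDiagram.card, mu.rowSum)) : mu = lam := by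
  have hcard : mu.shiftedDiagram.card ≤ lam.shiftedDiagram.card :=
    numEntries_eq hw ▸ hT.card_le_numEntries
  have hbox : ∀ c ∈ mu.shiftedDiagram, c.1 ≤ ∑ a ∈ T c, a / 2 := by
    intro c hc
    obtain ⟨a, ha⟩ := hT.nonempty c hc
    exact (hT.row_le ha).trans
      (Finset.single_le_sum (f := fun a => a / 2) (fun _ _ => Nat.zero_le _) ha)
  have hsum : ∑ c ∈ mu.shiftedDiagram, ∑ a ∈ T c, a / 2 = lam.rowSum := by
    have := congrArg (Finsupp.weight (fun i : ℕ => i)) hw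
    simpa [weight, rowWeight, map_sum, Finsupp.weight_single, rowSum] using this
  have hrow : mu.rowSum ≤ lam.rowSum := hsum ▸ Finset.sum_le_sum hbox
  rw [Prod.Lex.toLex_le_toLex] at hle
  have hcard' : mu.shiftedDiagram.card = lam.shiftedDiagram.card := by
    rcases hle with h | h
    · exact absurd h (not_lt.2 hcard)
    · exact h.1.symm
  have hrow' : mu.rowSum = ∑ c ∈ mu.shiftedDiagram, ∑ a ∈ T c, a / 2 := by
    rw [hsum]
    rcases hle with h | h
    · exact absurd h (not_lt.2 hcard)
    · exact le_antisymm hrow h.2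
  have h1 : ∀ c ∈ mu.shiftedDiagram, (T c).card = 1 := by
    have h2 : ∑ c ∈ mu.shiftedDiagram, 1 = ∑ c ∈ mu.shiftedDiagram, (T c).card := by
      rw [← Finset.card_eq_sum_ones, hcard', ← numEntries_eq hw, numEntries]
    intro c hc
    exact ((Finset.sum_eq_sum_iff_of_le fun c hc =>
      Finset.card_pos.2 (hT.nonempty c hc)).1 h2 c hc).symm
  have h3 := (Finset.sum_eq_sum_iff_of_le hbox).1 hrow'
  refine rowWeight_injective (hw ▸ Finset.sum_congr rfl fun c hc => ?_)
  obtain ⟨a, ha⟩ := Finset.card_eq_one.1 (h1 c hc)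
  have h4 := h3 c hc
  rw [ha, Finset.sum_singleton] at h4
  rw [ha, Finset.sum_singleton, h4]

theorem coeff_GP_rowWeight_ne_zero (lam : StrictPartition) :
    MvPowerSeries.coeff lam.rowWeight lam.GP ≠ 0 := by
  classical
  have h1 : MvPowerSeries.coeff lam.rowWeight lam.GP =
      (((lam.finite_setShYTP lam.rowWeight).toFinset.card : ℕ) : ℤ[X]) := by
    show ∑ T ∈ (lam.finite_setShYTP lam.rowWeight).toFinset, _ = _
    rw [Finset.sum_congr rfl (g := fun _ => 1) fun T hT => ?_, Finset.sum_const, nsmul_one]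
    rw [Set.Finite.mem_toFinset] at hT
    rw [numEntries_eq hT.2]
    simp
  rw [h1, Nat.cast_ne_zero, ← Nat.pos_iff_ne_zero, Finset.card_pos]
  let T : ℕ × ℕ → Finset ℕ := fun c => if c ∈ lam.shiftedDiagram then {2 * c.1 + 1} else ∅
  have hT : ∀ {c a}, a ∈ T c ↔ c ∈ lam.shiftedDiagram ∧ a = 2 * c.1 + 1 := fun {c a} => by
    simp only [T]
    split_ifs with h <;> simp [h]
  refine ⟨T, (Set.Finite.mem_toFinset _).2 ⟨⟨⟨fun c hc => ⟨_, hT.2 ⟨hc, rfl⟩⟩,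
    fun c hc => if_neg hc, ?_, ?_, ?_, ?_⟩, ?_⟩, ?_⟩⟩
  · intro i j j' _ a ha b hb
    rw [(hT.1 ha).2, (hT.1 hb).2]
  · intro i i' j hi a ha b hb
    rw [(hT.1 ha).2, (hT.1 hb).2]
    dsimp only
    omega
  · intro a _ i i' j ha hb
    have h2 := (hT.1 ha).2
    have h3 := (hT.1 hb).2
    dsimp only at h2 h3
    omega
  · intro a he i j j' ha _
    rw [(hT.1 ha).2] at he
    exact absurd he (by simp)
  · intro i a ha he
    rw [(hT.1 ha).2] at he
    exact absurd he (by simp)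
  · refine Finset.sum_congr rfl fun c hc => ?_
    rw [show T c = {2 * c.1 + 1} from if_pos hc, Finset.sum_singleton]
    congr 1
    omega

/-- In a linear relation, if `lam` is minimal for the size and then the sum of the row numbers, the
monomial `rowWeight lam` occurs in no other term than `GP lam`. -/
theorem linearIndependent_GP : LinearIndependent ℤ[X] GP := by
  rw [linearIndependent_iff]
  intro e he
  by_contra hne
  obtain ⟨lam, hlam, hmin⟩ := Finset.exists_min_image e.support
    (fun lam : StrictPartition => toLex (lam.shiftedDiagram.card, lam.rowSum))
    (Finsupp.support_nonempty_iff.2 hne)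
  have h1 := congrArg (MvPowerSeries.coeff lam.rowWeight) he
  rw [Finsupp.linearCombination_apply, Finsupp.sum, map_sum, map_zero,
    Finset.sum_eq_single lam ?_ (fun h => absurd hlam h)] at h1
  · rw [map_smul, smul_eq_mul, mul_eq_zero] at h1
    exact h1.elim (Finsupp.mem_support_iff.1 hlam) (coeff_GP_rowWeight_ne_zero lam)
  · intro mu hmu hneq
    rw [map_smul]
    have h2 : MvPowerSeries.coeff lam.rowWeight mu.GP = 0 := by
      refine Finset.sum_eq_zero fun T hT => absurd ?_ hneq
      rw [Set.Finite.mem_toFinset] at hT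
      exact eq_of_weight_eq_rowWeight hT.1 hT.2 (hmin mu hmu)
    rw [h2, smul_zero]

end StrictPartition

/-! ### Coefficients of the operator `hop` -/

/-- No two consecutive binary digits of `m` are `1`. -/
def Sparse (m : ℕ) : Prop := ∀ p, m.testBit p = true → m.testBit (p + 1) = false

theorem hopWeight_mem_range {A : Type*} [CommSemiring A] (φ : A →+* ℤ[X])
    (hX : Polynomial.X ∈ Set.range φ) {s c : Bool}
    (h : -Polynomial.X ∈ Set.range φ ∨ ¬ (s = true ∧ c = true)) (d : Bool) :
    hopWeight Polynomial.X s c d ∈ Set.range φ := by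
  have h0 : (0 : ℤ[X]) ∈ Set.range φ := ⟨0, map_zero φ⟩
  have h1 : (1 : ℤ[X]) ∈ Set.range φ := ⟨1, map_one φ⟩
  have h2 : (2 : ℤ[X]) ∈ Set.range φ := ⟨2, map_ofNat φ 2⟩
  cases s <;> cases c <;> cases d <;> simp only [hopWeight] <;> first | assumption | skip
  simpa using h

theorem algebraMap_hopWeight {R : Type*} [CommRing R] [Algebra ℤ[X] R] (s c d : Bool) :
    hopWeight (algebraMap ℤ[X] R Polynomial.X) s c d =
      algebraMap ℤ[X] R (hopWeight Polynomial.X s c d) := by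
  cases s <;> cases c <;> cases d <;>
    simp [hopWeight, map_ofNat (algebraMap ℤ[X] R) 2]

/-- The expansion of `hop` has coefficients in the image of `φ` as soon as the weight `-X` is in this
image or cannot occur. It is used with `φ` the identity and with `φ : ℕ[X] →+* ℤ[X]`. The
coefficients serve all algebras at once: power series, and `ℤ[X]` itself to evaluate them. -/
theorem exists_hop_eq_sum {A : Type*} [CommSemiring A] (φ : A →+* ℤ[X])
    (hX : Polynomial.X ∈ Set.range φ) (m : ℕ) : ∀ s : Bool,
    (-Polynomial.X ∈ Set.range φ ∨ Sparse m ∧ ¬ (s = true ∧ m.testBit 0 = true)) →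
    ∃ c : ℕ →₀ A, ∀ (R : Type) [CommRing R] [Algebra ℤ[X] R] (f : ℕ → R),
      hop (algebraMap ℤ[X] R Polynomial.X) s f m = c.sum fun n p => φ p • f n := by
  induction m using Nat.binaryRec' with
  | zero =>
    intro s _
    refine ⟨Finsupp.single (if s then 1 else 0) 1, fun R _ _ f => ?_⟩
    rw [Finsupp.sum_single_index (by simp), hop_zero]
    cases s <;> simp [hopBoundary]
  | bit c m _ ih =>
    intro s h
    have hw := hopWeight_mem_range φ hX (s := s) (c := c)
      (h.imp_right fun h => by simpa using h.2)
    obtain ⟨w0, hw0⟩ := hw false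
    obtain ⟨w1, hw1⟩ := hw true
    have hnext : ∀ d, -Polynomial.X ∈ Set.range φ ∨
        Sparse m ∧ ¬ (hopNext s c d = true ∧ m.testBit 0 = true) := by
      intro d
      refine h.imp_right fun h => ⟨fun p hp => ?_, ?_⟩
      · have := h.1 (p + 1)
        rw [Nat.testBit_bit_succ, Nat.testBit_bit_succ] at this
        exact this hp
      · rintro ⟨h1, h2⟩
        have hc : c = true := by cases s <;> cases c <;> cases d <;> simp_all [hopNext]
        have := h.1 0 (by rw [Nat.testBit_bit_zero, hc])
        rw [Nat.testBit_bit_succ, h2] at this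
        exact absurd this (by simp)
    obtain ⟨c0, hc0⟩ := ih _ (hnext false)
    obtain ⟨c1, hc1⟩ := ih _ (hnext true)
    refine ⟨w0 • c0.mapDomain (Nat.bit false) + w1 • c1.mapDomain (Nat.bit true),
      fun R _ _ f => ?_⟩
    rw [Finsupp.sum_add_index' (by simp) (by simp [add_smul]),
      Finsupp.sum_smul_index (by simp), Finsupp.sum_smul_index (by simp),
      Finsupp.sum_mapDomain_index (by simp) (by simp [mul_add, add_smul]),
      Finsupp.sum_mapDomain_index (by simp) (by simp [mul_add, add_smul]), hop_bit,
      hc0, hc1, algebraMap_hopWeight, algebraMap_hopWeight, ← hw0, ← hw1,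
      ← Algebra.smul_def, ← Algebra.smul_def]
    simp only [map_mul, mul_smul, Finsupp.smul_sum]

theorem hop_pointMass_self {R : Type*} [CommRing R] (b : R) (m : ℕ) :
    ∃ k : ℕ, hop b false (pointMass m) m = 2 ^ k := by
  induction m using Nat.binaryRec' with
  | zero => exact ⟨0, by simp [hop_zero, hopBoundary, pointMass]⟩
  | bit c m _ ih =>
    obtain ⟨k, hk⟩ := ih
    rw [hop_pointMass_bit]
    cases c
    · exact ⟨k, by simp [hopWeight, hopNext, hk]⟩
    · exact ⟨k + 1, by simp [hopWeight, hopNext, hk, pow_succ, mul_comm]⟩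

/-- The matrix entry in which both particles of the highest pair of consecutive digits `1` move and
all the others stay. -/
theorem exists_hop_pointMass_neg {R : Type*} [CommRing R] (b : R) (m : ℕ) (h : ¬ Sparse m) :
    ∃ n k : ℕ, hop b false (pointMass n) m = -(2 ^ k * b ^ 2) := by
  induction m using Nat.binaryRec' with
  | zero => exact absurd (fun p hp => by simp) h
  | bit c m _ ih =>
    by_cases hm : Sparse m
    · have h0 : c = true ∧ m.testBit 0 = true := by
        by_contra hc
        refine h fun p hp => ?_
        cases p with
        | zero =>
          rw [Nat.testBit_bit_zero] at hp
          rw [Nat.testBit_bit_succ]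
          simpa [hp] using hc
        | succ p =>
          rw [Nat.testBit_bit_succ] at hp ⊢
          exact hm p hp
      obtain ⟨rfl, h1⟩ := h0
      have h2 := hm 0 h1
      cases m using Nat.bitCasesOn with
      | bit c' m =>
      rw [Nat.testBit_bit_zero] at h1
      rw [Nat.testBit_bit_succ] at h2
      subst h1
      cases m using Nat.bitCasesOn with
      | bit c' m =>
      rw [Nat.testBit_bit_zero] at h2
      subst h2
      obtain ⟨k, hk⟩ := hop_pointMass_self b m
      refine ⟨Nat.bit false (Nat.bit true (Nat.bit true m)), k, ?_⟩
      rw [hop_pointMass_bit, hop_pointMass_bit, hop_pointMass_bit]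
      simp only [hopWeight, hopNext, hk]
      ring
    · obtain ⟨n, k, hk⟩ := ih hm
      cases c
      · exact ⟨Nat.bit false n, k, by rw [hop_pointMass_bit]; simp [hopWeight, hopNext, hk]⟩
      · refine ⟨Nat.bit true n, k + 1, ?_⟩
        rw [hop_pointMass_bit]
        simp only [hopWeight, hopNext, hk]
        ring

/-! ### Expansion of `GQ` -/

namespace StrictPartition

theorem GQ_eq_sum {A : Type*} [CommSemiring A] (φ : A →+* ℤ[X]) (mu : StrictPartition)
    {c : ℕ →₀ A} (hc : ∀ (R : Type) [CommRing R] [Algebra ℤ[X] R] (f : ℕ → R),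
      hop (algebraMap ℤ[X] R Polynomial.X) false f mu.code = c.sum fun n p => φ p • f n) :
    mu.GQ = c.sum fun n p => φ p • (ofCode n).GP := by
  ext1 d
  obtain ⟨k, hk⟩ : ∃ k, ∀ i, k ≤ i → d i = 0 :=
    ⟨d.support.sup id + 1, fun i hi => by
      by_contra h
      have := Finset.le_sup (f := id) (Finsupp.mem_support_iff.2 h)
      simp only [id] at this
      omega⟩
  have hP : ∀ n, MvPowerSeries.coeff d (ofCode n).GP = MvPowerSeries.coeff d
      (genFun (R := MvPowerSeries ℕ ℤ[X]) MvPowerSeries.X (MvPowerSeries.C Polynomial.X) false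
        (2 * k) n) := fun n => by
    have := coeff_genFun (ofCode n) false hk
    rw [code_ofCode] at this
    simpa using this.symm
  have hQ := coeff_genFun mu true hk
  rw [if_pos rfl] at hQ
  rw [← hQ, genFun_eq_hop, show (MvPowerSeries.C Polynomial.X : MvPowerSeries ℕ ℤ[X]) =
    algebraMap ℤ[X] _ Polynomial.X from rfl, hc, Finsupp.sum, Finsupp.sum, map_sum, map_sum]
  refine Finset.sum_congr rfl fun n _ => ?_
  rw [map_smul, map_smul, hP]
  rfl

theorem sparse_code_iff (mu : StrictPartition) :
    Sparse mu.code ↔ ∀ a ∈ mu.parts, ∀ b ∈ mu.parts, b < a → b + 2 ≤ a := by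
  constructor
  · intro h a ha b hb hlt
    by_contra hc
    obtain rfl : a = b + 1 := by omega
    obtain ⟨p, rfl⟩ : ∃ p, b = p + 1 := ⟨b - 1, by have := mu.pos b hb; omega⟩
    have := h p ((testBit_code mu p).2 hb)
    rw [(testBit_code mu (p + 1)).2 ha] at this
    exact absurd this (by simp)
  · intro h p hp
    by_contra hc
    rw [Bool.not_eq_false, testBit_code] at hc
    have := h _ hc _ ((testBit_code mu p).1 hp) (by omega)
    omega

end StrictPartition

theorem mainTheorem7 (mu : StrictPartition) :
    (∃ c : StrictPartition →₀ ℕ[X],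
      mu.GQ = c.sum fun lam p => p.map (Nat.castRingHom ℤ) • lam.GP) ↔
    ∀ a ∈ mu.parts, ∀ b ∈ mu.parts, b < a → b + 2 ≤ a := by
  rw [← mu.sparse_code_iff]
  constructor
  · rintro ⟨c, hc⟩
    by_contra hsparse
    obtain ⟨e, he⟩ := exists_hop_eq_sum (RingHom.id ℤ[X]) ⟨_, rfl⟩ mu.code false
      (Or.inl ⟨_, rfl⟩)
    have hQ := StrictPartition.GQ_eq_sum (RingHom.id ℤ[X]) mu he
    obtain ⟨n, k, hk⟩ := exists_hop_pointMass_neg (Polynomial.X : ℤ[X]) mu.code hsparse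
    -- the coefficients of `hop` are its values at the indicator functions
    have hen : e n = -(2 ^ k * Polynomial.X ^ 2) := by
      have h1 := he ℤ[X] (pointMass n)
      rw [Algebra.algebraMap_self, RingHom.id_apply, hk] at h1
      rw [h1]
      simp [pointMass, Finsupp.sum]
    have hinj : Function.Injective StrictPartition.ofCode :=
      Function.injective_surjInv StrictPartition.code_surjective
    have hcomb : Finsupp.linearCombination ℤ[X] StrictPartition.GP
        (c.mapRange (Polynomial.map (Nat.castRingHom ℤ)) (by simp)) =
        Finsupp.linearCombination ℤ[X] StrictPartition.GP
          (e.mapDomain StrictPartition.ofCode) := by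
      rw [Finsupp.linearCombination_apply, Finsupp.linearCombination_apply,
        Finsupp.sum_mapRange_index (by simp), Finsupp.sum_mapDomain_index (by simp)
        (by simp [add_smul]), ← hc, hQ]
      rfl
    have h2 := DFunLike.congr_fun (StrictPartition.linearIndependent_GP hcomb)
      (StrictPartition.ofCode n)
    rw [Finsupp.mapRange_apply, Finsupp.mapDomain_apply hinj, hen] at h2
    have h3 := congrArg (fun p : ℤ[X] => p.coeff 2) h2
    simp only [Polynomial.coeff_map, Polynomial.coeff_neg] at h3
    rw [show (2 : ℤ[X]) ^ k = Polynomial.C (2 ^ k) by simp, Polynomial.coeff_C_mul_X_pow,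
      if_pos rfl] at h3
    have h4 : (0 : ℤ) ≤ (Nat.castRingHom ℤ) ((c (StrictPartition.ofCode n)).coeff 2) := by simp
    have h5 : (0 : ℤ) < 2 ^ k := by positivity
    omega
  · intro hsparse
    obtain ⟨e, he⟩ := exists_hop_eq_sum (Polynomial.mapRingHom (Nat.castRingHom ℤ))
      ⟨Polynomial.X, by simp⟩ mu.code false (Or.inr ⟨hsparse, by simp⟩)
    refine ⟨e.mapDomain StrictPartition.ofCode, ?_⟩
    rw [Finsupp.sum_mapDomain_index (by simp) (by simp [add_smul])]
    simpa only [Polynomial.coe_mapRingHom] using StrictPartition.GQ_eq_sum _ mu he
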